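/- **Normalizing factors.** For $s\ge 1$, $n\ge 1$ let $Q_{0,s}$ be the following law of a family $\mathbf q=(q_i)_{1\le i\le s}$. * Independent case: $q_1=0$ and $q_2,\dots,q_s$ are i.i.d. $U(0,1)$. * Conformal case (calibration size $n$): let $S_1,\dots,S_{n+s}$ be i.i.d. $U(0,1)$; then $q_1=0$ and, for $2\le j\le s$, $q_j=\frac1{n+1}\sum_{k=1}^{n+1}\mathbf 1\{S_k\ge S_{n+j}\}$. For $\epsilon,\underline\pi_0\in(0,1)$ put $$c(s,\epsilon)=\mathbb E_{\mathbf q\sim Q_{0,s}}\Big[1\vee\max_{\lambda\in\{q_i\}\cap(0,1-\epsilon)}\frac{s(1-\lambda)}{1\vee\sum_{i=1}^s\mathbf 1\{q_i>\lambda\}}\Big],\qquad d(s,\epsilon)=\mathbb E_{\mathbf q\sim Q_{0,s}}\Big[\max_{\substack{0\le a\le b-\epsilon\\ a,b\in\{q_i\}\cup\{0,1\}}}\frac{s(b-a)}{1\vee\sum_{i=1}^s\mathbf 1\{q_i\in(a,b)\}}\Big]$$ (a maximum over the empty set is ignored), and $$C(m,\epsilon,\underline\pi_0)=\max_{\underline\pi_0m\le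 s\le m}c(s,\epsilon),\qquad D(m,\epsilon,\underline\pi_0)=\max_{\underline\pi_0m\le s\le m}d(s,\epsilon),$$ which in the conformal case also depend on $n$. **Proposition 4.8.** Let $m\to\infty$, where $\epsilon,\underline\pi_0\in(0,1)$ are allowed to depend on $m$ (and on $n$); precisely, $m,n,\epsilon,\underline\pi_0$ are functions of an index, and all limits and asymptotic relations are along a fixed filter on the index set (for instance, along a sequence). Write $u\gg v$ for $v=o(u)$. * In the independent case, if $m\to\infty$ and $\epsilon\gg\sqrt{(\log m)/(m\underline\pi_0)}$, then eventually $$C(m,\epsilon,\underline\pi_0)\vee D(m,\epsilon,\underline\pi_0)-1\le\frac{9}{\sqrt{m\underline\pi_0}\,\epsilon}.$$ * In the conformal case, if $n\wedge m\to\infty$, $1\gg\epsilon\gg\sqrt{(\log m)/((n\wedge m)\underline\pi_0)}$, $n\gg\log m$ and $\underline\pi_0\gg 1/m$, then eventually $$C(m,\epsilon,\underline\pi_0)\vee D(m,\epsilon,\underline\pi_0)-1\le\frac{34}{\sqrt{(n\wedge m)\underline\pi_0}\,\epsilon^2}.$$ -/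

import Mathlib

open Filter MeasureTheory Asymptotics Topology

noncomputable section

namespace NormalizingFactors

/-- The uniform distribution `U(0,1)`. -/
def unif : Measure ℝ := volume.restrict (Set.Ioo (0 : ℝ) 1)

/-- The least favorable law `Q_{0,s} = δ₀ × U(0,1)^{⊗ (s-1)}` of the independent setting, on families
of `s` null `p`-values: the first coordinate is `0` and the others are iid `U(0,1)`. -/
def lawIndep (s : ℕ) : Measure (Fin s → ℝ) :=
  Measure.pi fun i : Fin s => if (i : ℕ) = 0 then Measure.dirac (0 : ℝ) else unif

open Classical in
/-- The modified conformal `p`-value family `p̃^{0,i}`. The scores are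
`S (Sum.inl k) = S_k`, `k ∈ [n]` (calibration sample) and `S (Sum.inr j) = S_{n+j}`, `j ∈ [s]`
(test sample). The `i`-th `p`-value is replaced by `0`, and for `j ≠ i` the `j`-th one is
`(n+1)⁻¹ ∑_{k ∈ [n] ∪ {n+i}} 1{S_k ≥ S_{n+j}}`. -/
def modifiedPValue {n s : ℕ} (S : Fin n ⊕ Fin s → ℝ) (i j : Fin s) : ℝ :=
  if j = i then 0
  else ((∑ k : Fin n, if S (Sum.inl k) ≥ S (Sum.inr j) then (1 : ℝ) else 0)
      + (if S (Sum.inr i) ≥ S (Sum.inr j) then (1 : ℝ) else 0)) / ((n : ℝ) + 1)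

/-- The least favorable law `Q_{0,s}` of the conformal setting with a calibration sample of size `n`:
the law of `p̃^{0,1}` when the `n + s` scores are iid `U(0,1)`. (The first index of `Fin s` is
written `⟨0, j.pos⟩`, which exists as soon as there is some `j : Fin s`.) -/
def lawConf (n s : ℕ) : Measure (Fin s → ℝ) :=
  (Measure.pi fun _ : Fin n ⊕ Fin s => unif).map
    fun S j => modifiedPValue S ⟨0, j.pos⟩ j

/-- The number of coordinates of `q` that lie in `A`. -/
def count {s : ℕ} (q : Fin s → ℝ) (A : Set ℝ) : ℕ := Set.ncard {i : Fin s | q i ∈ A}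

/-- `1 ∨ max_{λ ∈ {q_i} ∩ (0,1-ε)} s (1-λ) / (1 ∨ ∑_i 1{q_i > λ})`. The supremum is over a finite
set; if that set is empty then its junk value `0` leaves the value `1` of the whole. -/
def storeyMax {s : ℕ} (ε : ℝ) (q : Fin s → ℝ) : ℝ :=
  max 1 (sSup {x : ℝ | ∃ lam ∈ Set.range q ∩ Set.Ioo 0 (1 - ε),
    x = (s : ℝ) * (1 - lam) / max 1 (count q (Set.Ioi lam) : ℝ)})

/-- `max_{I = (a,b)} s |I| / (1 ∨ ∑_i 1{q_i ∈ I})`, the maximum being over the open intervals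
`I = (a,b)` with `0 ≤ a ≤ b - ε` and `a, b ∈ {q_i} ∪ {0,1}`. This is a supremum over a finite set,
nonempty for `ε ≤ 1` because of `I = (0,1)`. -/
def intervalStoreyMax {s : ℕ} (ε : ℝ) (q : Fin s → ℝ) : ℝ :=
  sSup {x : ℝ | ∃ a ∈ Set.range q ∪ {0, 1}, ∃ b ∈ Set.range q ∪ {0, 1},
    0 ≤ a ∧ a ≤ b - ε ∧
    x = (s : ℝ) * (b - a) / max 1 (count q (Set.Ioo a b) : ℝ)}

/-- The normalizing factor `C(m,ε,π₀) = max_{π₀ m ≤ s ≤ m} c(s,ε)`, with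
`c(s,ε) = E_{q ∼ Q s} [storeyMax ε q]`, for a family of laws `Q s`, `s ≥ 1`. -/
def factorC (Q : (s : ℕ) → Measure (Fin s → ℝ)) (m : ℕ) (ε π₀ : ℝ) : ℝ :=
  sSup ((fun s : ℕ => ∫ q, storeyMax ε q ∂(Q s)) '' {s : ℕ | π₀ * m ≤ s ∧ s ≤ m})

/-- The normalizing factor `D(m,ε,π₀) = max_{π₀ m ≤ s ≤ m} d(s,ε)`, with
`d(s,ε) = E_{q ∼ Q s} [intervalStoreyMax ε q]`, for a family of laws `Q s`, `s ≥ 1`. -/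
def factorD (Q : (s : ℕ) → Measure (Fin s → ℝ)) (m : ℕ) (ε π₀ : ℝ) : ℝ :=
  sSup ((fun s : ℕ => ∫ q, intervalStoreyMax ε q ∂(Q s)) '' {s : ℕ | π₀ * m ≤ s ∧ s ≤ m})

end NormalizingFactors

end

/-! Both factors reduce to one expectation: an index `λ` in `storeyMax` competes in
`intervalStoreyMax` as the interval `(λ, 1)`, so bounding `d(s, ε)` uniformly over `s` suffices
(`max_factor_le`). If every interval `(a, b)` contains at least `s (b - a) - W` coordinates and `W ≤
s ε / 4`, each ratio is at most `1 + W / (s (b - a) - W) ≤ 1 + (4/3) W / (s ε)`. So what is needed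
is a uniform deviation `W` with mean of order `√s` and a Gaussian tail.

The absence of a logarithm comes from a martingale. For increasing sets `S k`, the sums over
coordinates of `(1_{S k} - p) / (1 - p)`, `p = ν (S k)`, form a martingale for the filtration that
knows coordinates inside `S k` exactly and of the others only that they lie outside. Exponentiating,
Doob's inequality controls the maximum over `k` at the price of the last term alone, and Hoeffding's
lemma bounds that term. Sets of mass at most `1/2` keep the compensated indicators in `[-1, 1]`;
hence lower and upper tails are treated separately, on a grid of `[0, 1/2]`, and intervals are
obtained by subtraction (`measure_le_maxDeviation`, `le_countIn_Ioo`).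

In the conformal case the same estimate for the calibration scores shows that each `p`-value is
uniformly close to one minus its score, so that a `p`-value lies in `(a, b)` as soon as its score
lies in a slightly shrunken reflected interval; the test scores then give the count. On the event of
large deviation the ratio is at most `s`, and the logarithmic lower bound on `ε` makes `s` times its
probability negligible. -/

namespace NormalizingFactors

open ProbabilityTheory

/-! ### Maximal inequality for compensated counts over increasing sets -/

section Martingale

/-- The indicator of `S`, centered and divided by the mass of the complement of `S`. -/
noncomputable def compensated (ν : Measure ℝ) (S : Set ℝ) (x : ℝ) : ℝ :=
  (S.indicator 1 x - ν.real S) / (1 - ν.real S)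

/-- On `S` the value does not depend on `S`: enlarging the set changes nothing for points already
inside, so increments vanish there. The bound `1/2` on the mass serves here only to keep the
denominator nonzero. -/
lemma compensated_of_mem {ν : Measure ℝ} {S : Set ℝ} (hS : ν.real S ≤ 1 / 2) {x : ℝ}
    (hx : x ∈ S) : compensated ν S x = 1 := by
  rw [compensated, Set.indicator_of_mem hx, Pi.one_apply, div_self]
  linarith

lemma compensated_of_notMem {ν : Measure ℝ} {S : Set ℝ} {x : ℝ}
    (hx : x ∉ S) : compensated ν S x = -ν.real S / (1 - ν.real S) := by
  rw [compensated, Set.indicator_of_notMem hx, zero_sub]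

lemma measurable_compensated {ν : Measure ℝ} {S : Set ℝ} (hS : MeasurableSet S) :
    Measurable (compensated ν S) :=
  ((measurable_one.indicator hS).sub_const _).div_const _

lemma compensated_mem_Icc {ν : Measure ℝ} {S : Set ℝ} (hS : ν.real S ≤ 1 / 2) (x : ℝ) :
    compensated ν S x ∈ Set.Icc (-1 : ℝ) 1 := by
  by_cases hx : x ∈ S
  · rw [compensated_of_mem hS hx]; norm_num
  · rw [compensated_of_notMem hx]
    have h0 : 0 ≤ ν.real S := measureReal_nonneg
    constructor
    · rw [le_div_iff₀ (by linarith)]; linarith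
    · rw [div_le_iff₀ (by linarith)]; linarith

lemma integral_compensated {ν : Measure ℝ} [IsProbabilityMeasure ν] {S : Set ℝ}
    (hS : MeasurableSet S) : ∫ x, compensated ν S x ∂ν = 0 := by
  simp only [compensated]
  rw [integral_div, integral_sub (f := S.indicator 1) ((integrable_const (1 : ℝ)).indicator hS)
    (integrable_const _)]
  simp [integral_indicator_one hS]

lemma integrable_compensated {ν μ : Measure ℝ} [IsFiniteMeasure μ] {S : Set ℝ}
    (hS : MeasurableSet S) (h : ν.real S ≤ 1 / 2) : Integrable (compensated ν S) μ :=
  Integrable.of_mem_Icc (-1) 1 (measurable_compensated hS).aemeasurable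
    (ae_of_all _ (compensated_mem_Icc h))

lemma hasSubgaussianMGF_compensated {ν : Measure ℝ} [IsProbabilityMeasure ν] {S : Set ℝ}
    (hS : MeasurableSet S) (h : ν.real S ≤ 1 / 2) :
    HasSubgaussianMGF (compensated ν S) 1 ν := by
  have := hasSubgaussianMGF_of_mem_Icc_of_integral_eq_zero (μ := ν) (a := -1) (b := 1)
    (measurable_compensated hS).aemeasurable (ae_of_all _ (compensated_mem_Icc h))
    (integral_compensated hS)
  convert this
  norm_num

variable {κ : Type*}

/-- Two families that agree except at indices where both lie outside `S`. -/
def AgreeOn (S : Set ℝ) (u v : κ → ℝ) : Prop := ∀ j, u j = v j ∨ (u j ∉ S ∧ v j ∉ S)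

/-- The filtration of the events that do not see where exactly the coordinates outside `S k` lie. -/
def blindFiltration (S : ℕ → Set ℝ) (hS : Monotone S) :
    Filtration ℕ (MeasurableSpace.pi : MeasurableSpace (κ → ℝ)) where
  seq k :=
    { MeasurableSet' := fun A => MeasurableSet A ∧ ∀ u v, AgreeOn (S k) u v → (u ∈ A ↔ v ∈ A)
      measurableSet_empty := by simp
      measurableSet_compl := fun A hA => ⟨hA.1.compl, fun u v h => not_congr (hA.2 u v h)⟩
      measurableSet_iUnion := fun f hf => ⟨MeasurableSet.iUnion fun i => (hf i).1, fun u v h => by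
        simp only [Set.mem_iUnion, (hf _).2 u v h]⟩ }
  mono' := fun k l hkl A hA => ⟨hA.1, fun u v h => hA.2 u v fun j =>
    (h j).imp_right fun h => ⟨fun h1 => h.1 (hS hkl h1), fun h1 => h.2 (hS hkl h1)⟩⟩
  le' := fun k A hA => hA.1

/-- The sum of the compensated indicators of the coordinates in `T`. -/
noncomputable def compensatedSum (ν : Measure ℝ) (T : Finset κ) (S : Set ℝ) (u : κ → ℝ) : ℝ :=
  ∑ i ∈ T, compensated ν S (u i)

lemma measurable_compensatedSum {ν : Measure ℝ} {T : Finset κ} {S : Set ℝ} (hS : MeasurableSet S) :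
    Measurable (compensatedSum ν T S) :=
  Finset.measurable_sum _ fun i _ => (measurable_compensated hS).comp (measurable_pi_apply i)

lemma compensatedSum_congr {ν : Measure ℝ} {T : Finset κ} {S : Set ℝ} {u v : κ → ℝ}
    (h : AgreeOn S u v) : compensatedSum ν T S u = compensatedSum ν T S v := by
  refine Finset.sum_congr rfl fun i _ => ?_
  rcases h i with h | h
  · rw [h]
  · rw [compensated_of_notMem h.1, compensated_of_notMem h.2]

lemma abs_compensatedSum_le {ν : Measure ℝ} {T : Finset κ} {S : Set ℝ} (hS : ν.real S ≤ 1 / 2)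
    (u : κ → ℝ) : |compensatedSum ν T S u| ≤ T.card := by
  refine (Finset.abs_sum_le_sum_abs _ _).trans ?_
  refine (Finset.sum_le_card_nsmul _ _ 1 fun i _ => abs_le.2 ?_).trans (by simp)
  exact compensated_mem_Icc hS _

variable [Fintype κ]

/-- This is the orthogonality of martingale increments. Since `h` vanishes on `S`, only `u i ∉ S`
matters, and there `Φ` does not see `u i`. Freezing that coordinate at a point `x₀ ∉ S` leaves the
product unchanged and makes the first factor a function of the other coordinates, hence independent
of `h (u i)`. -/
lemma integral_mul_eq_zero_of_agreeOn {μ : κ → Measure ℝ} [∀ i, IsProbabilityMeasure (μ i)]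
    (i : κ) {S : Set ℝ} {Φ : (κ → ℝ) → ℝ} (hΦm : Measurable Φ)
    (hΦ : ∀ u v, AgreeOn S u v → Φ u = Φ v) {h : ℝ → ℝ} (hm : Measurable h)
    (h0 : ∀ x ∈ S, h x = 0) (hint : ∫ x, h x ∂(μ i) = 0) :
    ∫ u, Φ u * h (u i) ∂(Measure.pi μ) = 0 := by
  classical
  by_cases hS : S = Set.univ
  · simp [h0 _ (hS ▸ Set.mem_univ _)]
  obtain ⟨x₀, hx₀⟩ := (Set.ne_univ_iff_exists_notMem S).1 hS
  let J : Finset κ := Finset.univ.erase i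
  let ψ : (J → ℝ) → κ → ℝ := fun w j => if hj : j ∈ J then w ⟨j, hj⟩ else x₀
  have hψ : Measurable ψ := by
    refine measurable_pi_lambda _ fun j => ?_
    by_cases hj : j ∈ J
    · simp only [ψ, hj, dite_true]; exact measurable_pi_apply _
    · simp only [ψ, hj, dite_false]; exact measurable_const
  have key : ∀ u : κ → ℝ, Φ u * h (u i) = Φ (ψ fun j => u j) * h (u i) := by
    intro u
    by_cases hu : u i ∈ S
    · simp [h0 _ hu]
    · congr 1
      refine hΦ _ _ fun j => ?_
      by_cases hj : j = i
      · subst hj; right; simp [ψ, J, hu, hx₀]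
      · left; simp [ψ, J, hj]
  have hind : iIndepFun (fun (j : κ) (u : κ → ℝ) => u j) (Measure.pi μ) :=
    iIndepFun_pi (X := fun _ => id) fun j => aemeasurable_id
  have h2 := hind.indepFun_finset J {i} (by simp [J]) fun j => measurable_pi_apply j
  have h3 := h2.comp (φ := fun w => Φ (ψ w))
    (ψ := fun w : (({i} : Finset κ) → ℝ) => h (w ⟨i, by simp⟩)) (hΦm.comp hψ)
    (hm.comp (measurable_pi_apply _))
  simp_rw [key]
  have h4 := h3.integral_fun_mul_eq_mul_integral
    ((hΦm.comp hψ).comp (measurable_pi_lambda _ fun j => measurable_pi_apply _)).aestronglyMeasurable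
    ((hm.comp (measurable_pi_apply _)).comp
      (measurable_pi_lambda _ fun j => measurable_pi_apply _)).aestronglyMeasurable
  simp only [Function.comp_def] at h4
  rw [h4]
  have h5 : ∫ u, h (u i) ∂(Measure.pi μ) = 0 := by
    rw [← hint, ← (measurePreserving_eval μ i).map_eq,
      integral_map (measurable_pi_apply i).aemeasurable hm.aestronglyMeasurable]
  rw [h5, mul_zero]

variable {μ : κ → Measure ℝ} [∀ i, IsProbabilityMeasure (μ i)] {ν : Measure ℝ}
  {T : Finset κ}

lemma integrable_exp_compensatedSum {S : Set ℝ} (hS : MeasurableSet S) (h : ν.real S ≤ 1 / 2)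
    (t : ℝ) : Integrable (fun u => Real.exp (t * compensatedSum ν T S u)) (Measure.pi μ) := by
  refine integrable_exp_mul_of_mem_Icc (a := -T.card) (b := T.card)
    (measurable_compensatedSum hS).aemeasurable (ae_of_all _ fun u => ?_)
  exact abs_le.1 (abs_compensatedSum_le h u)

variable [IsProbabilityMeasure ν]

lemma integral_exp_compensatedSum_le (hT : ∀ i ∈ T, μ i = ν) {S : Set ℝ} (hS : MeasurableSet S)
    (h : ν.real S ≤ 1 / 2) (t : ℝ) :
    ∫ u, Real.exp (t * compensatedSum ν T S u) ∂(Measure.pi μ)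
      ≤ Real.exp (T.card * t ^ 2 / 2) := by
  have hind : iIndepFun (fun (j : κ) (u : κ → ℝ) => compensated ν S (u j)) (Measure.pi μ) :=
    iIndepFun_pi fun j => (measurable_compensated hS).aemeasurable
  have h1 : ∀ i ∈ T, HasSubgaussianMGF (fun u : κ → ℝ => compensated ν S (u i)) 1
      (Measure.pi μ) := by
    intro i hi
    refine HasSubgaussianMGF.of_map (Y := fun u : κ → ℝ => u i) (X := compensated ν S)
      (measurable_pi_apply i).aemeasurable ?_
    rw [(measurePreserving_eval μ i).map_eq, hT i hi]
    exact hasSubgaussianMGF_compensated hS h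
  have h2 := (HasSubgaussianMGF.sum_of_iIndepFun hind h1).mgf_le t
  simpa [mgf, compensatedSum] using h2

variable {S : ℕ → Set ℝ}

lemma submartingale_exp_compensatedSum (hT : ∀ i ∈ T, μ i = ν) (hmono : Monotone S)
    (hS : ∀ k, MeasurableSet (S k)) (h : ∀ k, ν.real (S k) ≤ 1 / 2) (t : ℝ) :
    Submartingale (fun k u => Real.exp (t * compensatedSum ν T (S k) u))
      (blindFiltration S hmono) (Measure.pi μ) := by
  refine submartingale_of_setIntegral_le_succ (fun k => ?_)
    (fun k => integrable_exp_compensatedSum (hS k) (h k) t) fun k A hA => ?_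
  · have hm : Measurable[blindFiltration S hmono k]
        fun u => Real.exp (t * compensatedSum ν T (S k) u) := by
      intro B hB
      refine ⟨((measurable_compensatedSum (hS k)).const_mul t).exp hB, fun u v huv => ?_⟩
      simp only [Set.mem_preimage, compensatedSum_congr huv]
    exact hm.stronglyMeasurable
  -- Convexity gives `exp (t b) ≥ exp (t a) + t exp (t a) (b - a)`. With `Φ` the slope restricted to
  -- `A`, the linear term integrates to zero, coordinate by coordinate.
  · set Φ : (κ → ℝ) → ℝ := fun u =>
      A.indicator (fun u => t * Real.exp (t * compensatedSum ν T (S k) u)) u with hΦ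
    have hΦm : Measurable Φ := by
      refine Measurable.indicator ?_ hA.1
      exact (((measurable_compensatedSum (hS k)).const_mul t).exp).const_mul t
    have hΦc : ∀ u v, AgreeOn (S k) u v → Φ u = Φ v := by
      intro u v huv
      have := hA.2 u v huv
      by_cases hu : u ∈ A
      · simp only [hΦ, Set.indicator_of_mem hu, Set.indicator_of_mem (this.1 hu),
          compensatedSum_congr huv]
      · simp only [hΦ, Set.indicator_of_notMem hu, Set.indicator_of_notMem (mt this.2 hu)]
    let δ : ℝ → ℝ := fun x => compensated ν (S (k + 1)) x - compensated ν (S k) x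
    have hδm : Measurable δ :=
      (measurable_compensated (hS _)).sub (measurable_compensated (hS _))
    have hδ : ∀ i ∈ T, ∫ u, Φ u * δ (u i) ∂(Measure.pi μ) = 0 := by
      intro i hi
      refine integral_mul_eq_zero_of_agreeOn i hΦm hΦc hδm (fun x hx => ?_) ?_
      · simp only [δ]
        rw [compensated_of_mem (h _) hx, compensated_of_mem (h _) (hmono (Nat.le_succ k) hx),
          sub_self]
      · rw [hT i hi, integral_sub (integrable_compensated (hS _) (h _))
          (integrable_compensated (hS _) (h _)), integral_compensated (hS _),
          integral_compensated (hS _), sub_self]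
    have hΦb : ∀ u, ‖Φ u‖ ≤ |t| * Real.exp (|t| * T.card) := by
      intro u
      refine (norm_indicator_le_norm_self _ _).trans ?_
      rw [norm_mul, Real.norm_eq_abs, Real.norm_eq_abs, Real.abs_exp]
      refine mul_le_mul_of_nonneg_left (Real.exp_le_exp.2 ?_) (abs_nonneg _)
      refine (le_abs_self _).trans ?_
      rw [abs_mul]
      refine mul_le_mul_of_nonneg_left ?_ (abs_nonneg _)
      exact abs_compensatedSum_le (h k) u
    have hint : ∀ i ∈ T, Integrable (fun u => Φ u * δ (u i)) (Measure.pi μ) := by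
      intro i _
      refine Integrable.of_bound (C := |t| * Real.exp (|t| * T.card) * 2)
        (hΦm.mul (hδm.comp (measurable_pi_apply i))).aestronglyMeasurable (ae_of_all _ fun u => ?_)
      rw [norm_mul]
      refine mul_le_mul (hΦb u) ?_ (norm_nonneg _) (by positivity)
      have h1 := compensated_mem_Icc (h k) (u i)
      have h2 := compensated_mem_Icc (h (k + 1)) (u i)
      rw [Real.norm_eq_abs, abs_le]
      simp only [δ]
      constructor <;> linarith [h1.1, h1.2, h2.1, h2.2]
    have hsum : ∫ u, ∑ i ∈ T, Φ u * δ (u i) ∂(Measure.pi μ) = 0 := by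
      rw [integral_finsetSum _ hint]
      exact Finset.sum_eq_zero hδ
    rw [← integral_indicator hA.1, ← integral_indicator hA.1]
    rw [← add_zero (∫ u, A.indicator _ u ∂_), ← hsum, ← integral_add
      ((integrable_exp_compensatedSum (hS k) (h k) t).indicator hA.1)
      (integrable_finsetSum _ hint)]
    refine integral_mono (((integrable_exp_compensatedSum (hS k) (h k) t).indicator hA.1).add
      (integrable_finsetSum _ hint))
      ((integrable_exp_compensatedSum (hS (k + 1)) (h (k + 1)) t).indicator hA.1) fun u => ?_
    by_cases hu : u ∈ A
    · simp only [hΦ, Set.indicator_of_mem hu]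
      rw [← Finset.mul_sum]
      have e : ∑ i ∈ T, δ (u i) =
          compensatedSum ν T (S (k + 1)) u - compensatedSum ν T (S k) u := by
        simp only [δ, Finset.sum_sub_distrib, compensatedSum]
      rw [e]
      set a := compensatedSum ν T (S k) u
      set b := compensatedSum ν T (S (k + 1)) u
      have h1 : t * b = t * a + t * (b - a) := by ring
      rw [h1, Real.exp_add]
      nlinarith [Real.add_one_le_exp (t * (b - a)), Real.exp_pos (t * a)]
    · simp [hΦ, Set.indicator_of_notMem hu]

/-- Doob's inequality for the exponential submartingale: the maximum over `k ≤ K` obeys the Chernoff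
bound of a single sum, whatever `K` is. The sign `σ` gives both sides of the deviation. -/
lemma measure_exists_le_compensatedSum (hT : ∀ i ∈ T, μ i = ν) (hmono : Monotone S)
    (hS : ∀ k, MeasurableSet (S k)) (h : ∀ k, ν.real (S k) ≤ 1 / 2) (K : ℕ) {x : ℝ} (hx : 0 < x)
    (hcard : 0 < T.card) {σ : ℝ} (hσ : σ ^ 2 = 1) :
    Measure.pi μ {u | ∃ k ≤ K, x ≤ σ * compensatedSum ν T (S k) u}
      ≤ ENNReal.ofReal (Real.exp (-x ^ 2 / (2 * T.card))) := by
  set N : ℝ := (T.card : ℝ) with hN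
  have hN0 : 0 < N := Nat.cast_pos.2 hcard
  -- The minimizer of `N t² / 2 - t x`.
  set t : ℝ := x / N with ht
  have ht0 : 0 < t := by positivity
  have hsub := submartingale_exp_compensatedSum hT hmono hS h (σ * t)
  have hmax := maximal_ineq hsub (fun k u => (Real.exp_pos _).le)
    (ε := ⟨Real.exp (t * x), (Real.exp_pos _).le⟩) K
  set A : Set (κ → ℝ) := {u | ((⟨Real.exp (t * x), (Real.exp_pos _).le⟩ : NNReal) : ℝ) ≤
    (Finset.range (K + 1)).sup' Finset.nonempty_range_add_one
      fun k => Real.exp (σ * t * compensatedSum ν T (S k) u)} with hA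
  have hsubset : {u | ∃ k ≤ K, x ≤ σ * compensatedSum ν T (S k) u} ⊆ A := by
    rintro u ⟨k, hk, hku⟩
    refine le_trans ?_ (Finset.le_sup' (fun k => Real.exp (σ * t * compensatedSum ν T (S k) u))
      (Finset.mem_range.2 (Nat.lt_succ_of_le hk)))
    refine Real.exp_le_exp.2 ?_
    calc t * x ≤ t * (σ * compensatedSum ν T (S k) u) := by gcongr
      _ = _ := by ring
  have hint : ∫ u in A, Real.exp (σ * t * compensatedSum ν T (S K) u) ∂(Measure.pi μ)
      ≤ Real.exp (N * t ^ 2 / 2) := by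
    refine (setIntegral_le_integral (integrable_exp_compensatedSum (hS K) (h K) (σ * t))
      (ae_of_all _ fun u => (Real.exp_pos _).le)).trans ?_
    refine (integral_exp_compensatedSum_le hT (hS K) (h K) (σ * t)).trans ?_
    rw [mul_pow, hσ, one_mul]
  have h1 : ENNReal.ofReal (Real.exp (t * x)) * Measure.pi μ A
      ≤ ENNReal.ofReal (Real.exp (N * t ^ 2 / 2)) := by
    refine le_trans (le_of_eq ?_) (hmax.trans (ENNReal.ofReal_le_ofReal hint))
    congr 1
    rw [ENNReal.ofReal, Real.toNNReal_of_nonneg (Real.exp_pos _).le]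
    rfl
  have h2 : Measure.pi μ A
      ≤ ENNReal.ofReal (Real.exp (N * t ^ 2 / 2)) / ENNReal.ofReal (Real.exp (t * x)) := by
    rw [ENNReal.le_div_iff_mul_le (Or.inl (by simp [Real.exp_pos])) (Or.inl ENNReal.ofReal_ne_top),
      mul_comm]
    exact h1
  refine (measure_mono hsubset).trans (h2.trans (le_of_eq ?_))
  rw [← ENNReal.ofReal_div_of_pos (Real.exp_pos _), ← Real.exp_sub]
  congr 2
  rw [ht]; field_simp; ring

end Martingale

end NormalizingFactors

namespace NormalizingFactors

/-! ### Uniform deviation of the counts of a uniform sample -/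

section Uniform

instance : IsProbabilityMeasure unif := ⟨by simp [unif]⟩

lemma unif_real_Iio {t : ℝ} (h0 : 0 ≤ t) (h1 : t ≤ 1) : unif.real (Set.Iio t) = t := by
  have : Set.Iio t ∩ Set.Ioo 0 1 = Set.Ioo 0 t := by
    ext x; simp only [Set.mem_inter_iff, Set.mem_Iio, Set.mem_Ioo]
    constructor
    · rintro ⟨a, b, c⟩; exact ⟨b, a⟩
    · rintro ⟨a, b⟩; exact ⟨b, a, b.trans_le h1⟩
  rw [unif, measureReal_restrict_apply measurableSet_Iio, this]
  simp [h0]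

lemma unif_real_Ioi {t : ℝ} (h0 : 0 ≤ t) (h1 : t ≤ 1) : unif.real (Set.Ioi t) = 1 - t := by
  have : Set.Ioi t ∩ Set.Ioo 0 1 = Set.Ioo t 1 := by
    ext x; simp only [Set.mem_inter_iff, Set.mem_Ioi, Set.mem_Ioo]
    constructor
    · rintro ⟨a, b, c⟩; exact ⟨a, c⟩
    · rintro ⟨a, b⟩; exact ⟨a, h0.trans_lt a, b⟩
  rw [unif, measureReal_restrict_apply measurableSet_Ioi, this]
  simp [h1]

/-- The points `k / (2 N)`, `k ≤ N`, of a grid of `[0, 1/2]`. -/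
noncomputable def gridPoint (N k : ℕ) : ℝ := min (k / (2 * N)) (1 / 2)

lemma gridPoint_nonneg (N k : ℕ) : 0 ≤ gridPoint N k := le_min (by positivity) (by norm_num)

lemma gridPoint_le (N k : ℕ) : gridPoint N k ≤ 1 / 2 := min_le_right _ _

lemma gridPoint_mono (N : ℕ) : Monotone (gridPoint N) := fun a b h => by
  unfold gridPoint; gcongr

/-- Consecutive grid points are `1 / (2 N)` apart, so rounding moves the expected count `N t` by
less than `1`. -/
lemma exists_gridPoint_le {N : ℕ} (hN : 0 < N) {t : ℝ} (h0 : 0 ≤ t) (h1 : t ≤ 1 / 2) :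
    ∃ k ≤ N, gridPoint N k ≤ t ∧ N * t ≤ N * gridPoint N k + 1 := by
  have hN' : (0 : ℝ) < N := Nat.cast_pos.2 hN
  have hfl := Nat.floor_le (a := 2 * N * t) (by positivity)
  have hlt := Nat.lt_floor_add_one (2 * N * t)
  have e : ((⌊2 * N * t⌋₊ : ℕ) : ℝ) / (2 * N) ≤ t := by
    rw [div_le_iff₀ (by positivity)]; linarith
  refine ⟨⌊2 * N * t⌋₊, ?_, ?_, ?_⟩
  · refine Nat.floor_le_of_le ?_
    nlinarith
  · exact (min_le_left _ _).trans e
  · rw [gridPoint, min_eq_left (e.trans h1)]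
    have : (N : ℝ) * ((⌊2 * N * t⌋₊ : ℕ) / (2 * N)) = (⌊2 * N * t⌋₊ : ℕ) / 2 := by field_simp
    rw [this]; linarith

lemma exists_lt_gridPoint {N : ℕ} (hN : 0 < N) {t : ℝ} (h0 : 0 ≤ t) (h1 : t < 1 / 2) :
    ∃ k ≤ N, t < gridPoint N k ∧ N * gridPoint N k ≤ N * t + 1 := by
  have hN' : (0 : ℝ) < N := Nat.cast_pos.2 hN
  have hfl := Nat.floor_le (a := 2 * N * t) (by positivity)
  have hlt := Nat.lt_floor_add_one (2 * N * t)
  refine ⟨⌊2 * N * t⌋₊ + 1, ?_, ?_, ?_⟩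
  · refine Nat.succ_le_of_lt ((Nat.floor_lt (by positivity)).2 ?_)
    nlinarith
  · refine lt_min ?_ h1
    rw [lt_div_iff₀ (by positivity)]; push_cast; linarith
  · have : (N : ℝ) * (((⌊2 * N * t⌋₊ + 1 : ℕ) : ℝ) / (2 * N)) = (⌊2 * N * t⌋₊ + 1) / 2 := by
      push_cast; field_simp
    refine (mul_le_mul_of_nonneg_left (min_le_left _ _) hN'.le).trans ?_
    rw [this]; linarith

variable {κ : Type*}

/-- The largest deviation, over a grid, of the compensated counts of the lower and upper tails of
the family `(u i)`, `i ∈ T`. -/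
noncomputable def maxDeviation (T : Finset κ) (u : κ → ℝ) : ℝ :=
  (Finset.range (T.card + 1)).sup' Finset.nonempty_range_add_one fun k =>
    max |compensatedSum unif T (Set.Iio (gridPoint T.card k)) u|
      |compensatedSum unif T (Set.Ioi (1 - gridPoint T.card k)) u|

variable {T : Finset κ}

lemma measurable_maxDeviation : Measurable (maxDeviation T) := by
  have : maxDeviation T = (Finset.range (T.card + 1)).sup' Finset.nonempty_range_add_one
      fun k u => max |compensatedSum unif T (Set.Iio (gridPoint T.card k)) u|
      |compensatedSum unif T (Set.Ioi (1 - gridPoint T.card k)) u| := by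
    ext u; rw [maxDeviation, Finset.sup'_apply]
  rw [this]
  refine Finset.measurable_sup' _ fun k _ => ?_
  have h1 := measurable_compensatedSum (ν := unif) (T := T)
    (measurableSet_Iio (a := gridPoint T.card k))
  have h2 := measurable_compensatedSum (ν := unif) (T := T)
    (measurableSet_Ioi (a := 1 - gridPoint T.card k))
  exact (continuous_abs.measurable.comp h1).max (continuous_abs.measurable.comp h2)

lemma abs_compensatedSum_Iio_le_maxDeviation {k : ℕ} (hk : k ≤ T.card) (u : κ → ℝ) :
    |compensatedSum unif T (Set.Iio (gridPoint T.card k)) u| ≤ maxDeviation T u :=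
  (le_max_left _ _).trans (Finset.le_sup' (fun k =>
    max |compensatedSum unif T (Set.Iio (gridPoint T.card k)) u|
      |compensatedSum unif T (Set.Ioi (1 - gridPoint T.card k)) u|)
    (Finset.mem_range.2 (Nat.lt_succ_of_le hk)))

lemma abs_compensatedSum_Ioi_le_maxDeviation {k : ℕ} (hk : k ≤ T.card) (u : κ → ℝ) :
    |compensatedSum unif T (Set.Ioi (1 - gridPoint T.card k)) u| ≤ maxDeviation T u :=
  (le_max_right _ _).trans (Finset.le_sup' (fun k =>
    max |compensatedSum unif T (Set.Iio (gridPoint T.card k)) u|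
      |compensatedSum unif T (Set.Ioi (1 - gridPoint T.card k)) u|)
    (Finset.mem_range.2 (Nat.lt_succ_of_le hk)))

lemma maxDeviation_nonneg (u : κ → ℝ) : 0 ≤ maxDeviation T u :=
  (abs_nonneg _).trans (abs_compensatedSum_Iio_le_maxDeviation (Nat.zero_le _) u)

/-- The number of indices `i ∈ T` with `u i ∈ A`, as a real number. -/
noncomputable def countIn (T : Finset κ) (u : κ → ℝ) (A : Set ℝ) : ℝ :=
  ∑ i ∈ T, A.indicator 1 (u i)

lemma countIn_mono {A B : Set ℝ} (h : A ⊆ B) (u : κ → ℝ) : countIn T u A ≤ countIn T u B :=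
  Finset.sum_le_sum fun _ _ => Set.indicator_le_indicator_of_subset h (fun _ => zero_le_one) _

lemma countIn_union_le (A B : Set ℝ) (u : κ → ℝ) :
    countIn T u (A ∪ B) ≤ countIn T u A + countIn T u B := by
  rw [countIn, countIn, countIn, ← Finset.sum_add_distrib]
  refine Finset.sum_le_sum fun i _ => ?_
  by_cases hA : u i ∈ A <;> by_cases hB : u i ∈ B <;> simp [hA, hB]

lemma countIn_add_countIn_compl (A : Set ℝ) (u : κ → ℝ) :
    countIn T u A + countIn T u Aᶜ = T.card := by
  rw [countIn, countIn, ← Finset.sum_add_distrib]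
  simp [Set.indicator_self_add_compl_apply]

/-- The centered count is `1 - ν.real S ≤ 1` times the compensated sum. -/
lemma abs_countIn_sub_le_compensatedSum {ν : Measure ℝ} {S : Set ℝ} (hS : ν.real S ≤ 1 / 2)
    (u : κ → ℝ) : |countIn T u S - T.card * ν.real S| ≤ |compensatedSum ν T S u| := by
  have h0 : 0 ≤ ν.real S := measureReal_nonneg
  have e : countIn T u S - T.card * ν.real S = (1 - ν.real S) * compensatedSum ν T S u := by
    rw [compensatedSum, Finset.mul_sum]
    have : ∀ i ∈ T, (1 - ν.real S) * compensated ν S (u i)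
        = S.indicator 1 (u i) - ν.real S := by
      intro i _
      have : 1 - ν.real S ≠ 0 := by linarith
      rw [compensated, mul_div_cancel₀ _ this]
    rw [Finset.sum_congr rfl this, Finset.sum_sub_distrib, countIn]
    simp
  rw [e, abs_mul, abs_of_nonneg (by linarith : 0 ≤ 1 - ν.real S)]
  exact mul_le_of_le_one_left (abs_nonneg _) (by linarith)

lemma abs_countIn_Iio_sub_le {k : ℕ} (hk : k ≤ T.card) (u : κ → ℝ) :
    |countIn T u (Set.Iio (gridPoint T.card k)) - T.card * gridPoint T.card k|
      ≤ maxDeviation T u := by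
  have hp := unif_real_Iio (gridPoint_nonneg T.card k)
    ((gridPoint_le T.card k).trans (by norm_num))
  have h2 := abs_countIn_sub_le_compensatedSum (T := T) (hp.trans_le (gridPoint_le _ k)) u
  rw [hp] at h2
  exact h2.trans (abs_compensatedSum_Iio_le_maxDeviation hk u)

lemma abs_countIn_Ioi_sub_le {k : ℕ} (hk : k ≤ T.card) (u : κ → ℝ) :
    |countIn T u (Set.Ioi (1 - gridPoint T.card k)) - T.card * gridPoint T.card k|
      ≤ maxDeviation T u := by
  have hp := unif_real_Ioi (t := 1 - gridPoint T.card k) (by linarith [gridPoint_le T.card k])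
    (by linarith [gridPoint_nonneg T.card k])
  rw [sub_sub_cancel] at hp
  have h2 := abs_countIn_sub_le_compensatedSum (T := T) (hp.trans_le (gridPoint_le _ k)) u
  rw [hp] at h2
  exact h2.trans (abs_compensatedSum_Ioi_le_maxDeviation hk u)

lemma le_countIn_Iio (hT : 0 < T.card) {t : ℝ} (h0 : 0 ≤ t) (h1 : t ≤ 1) (u : κ → ℝ) :
    T.card * t - maxDeviation T u - 1 ≤ countIn T u (Set.Iio t) := by
  rcases le_or_gt t (1 / 2) with ht | ht
  · obtain ⟨k, hk, hkt, hkN⟩ := exists_gridPoint_le hT h0 ht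
    have h3 := abs_le.1 (abs_countIn_Iio_sub_le hk u)
    have h4 := countIn_mono (T := T) (Set.Iio_subset_Iio hkt) u
    linarith [h3.1]
  -- Beyond `1/2` the complement is a small upper tail; it is bounded from above instead.
  · obtain ⟨k, hk, hkt, hkN⟩ := exists_lt_gridPoint hT (t := 1 - t) (by linarith) (by linarith)
    have h3 := abs_le.1 (abs_countIn_Ioi_sub_le hk u)
    have h4 : countIn T u (Set.Iio t)ᶜ ≤ countIn T u (Set.Ioi (1 - gridPoint T.card k)) := by
      refine countIn_mono (fun x hx => ?_) u
      rw [Set.compl_Iio, Set.mem_Ici] at hx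
      exact Set.mem_Ioi.2 (by linarith)
    linarith [h3.2, countIn_add_countIn_compl (T := T) (Set.Iio t) u]

lemma countIn_Iic_le (hT : 0 < T.card) {t : ℝ} (h0 : 0 ≤ t) (h1 : t ≤ 1) (u : κ → ℝ) :
    countIn T u (Set.Iic t) ≤ T.card * t + maxDeviation T u + 1 := by
  rcases lt_or_ge t (1 / 2) with ht | ht
  · obtain ⟨k, hk, hkt, hkN⟩ := exists_lt_gridPoint hT h0 ht
    have h3 := abs_le.1 (abs_countIn_Iio_sub_le hk u)
    have h4 := countIn_mono (T := T) (fun x (hx : x ∈ Set.Iic t) =>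
      Set.mem_Iio.2 (lt_of_le_of_lt hx hkt)) u
    linarith [h3.2]
  · obtain ⟨k, hk, hkt, hkN⟩ := exists_gridPoint_le hT (t := 1 - t) (by linarith) (by linarith)
    have h3 := abs_le.1 (abs_countIn_Ioi_sub_le hk u)
    have h4 : countIn T u (Set.Ioi (1 - gridPoint T.card k)) ≤ countIn T u (Set.Iic t)ᶜ := by
      rw [Set.compl_Iic]
      exact countIn_mono (Set.Ioi_subset_Ioi (by linarith)) u
    linarith [h3.1, countIn_add_countIn_compl (T := T) (Set.Iic t) u]

lemma le_countIn_Ioo (hT : 0 < T.card) {a b : ℝ} (h0 : 0 ≤ a) (hab : a ≤ b) (h1 : b ≤ 1)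
    (u : κ → ℝ) :
    T.card * (b - a) - 2 * maxDeviation T u - 2 ≤ countIn T u (Set.Ioo a b) := by
  have h2 := le_countIn_Iio hT (h0.trans hab) h1 u
  have h3 := countIn_Iic_le hT h0 (hab.trans h1) u
  have h4 := (countIn_mono (T := T) (fun x (hx : x ∈ Set.Iio b) =>
    show x ∈ Set.Ioo a b ∪ Set.Iic a from
      (le_or_gt x a).elim Or.inr fun h => Or.inl ⟨h, hx⟩) u).trans (countIn_union_le _ _ u)
  linarith

variable [Fintype κ] {μ : κ → Measure ℝ} [∀ i, IsProbabilityMeasure (μ i)]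

/-- The factor `4` counts two tails and two signs; the number of grid points does not enter. -/
lemma measure_le_maxDeviation (hT : ∀ i ∈ T, μ i = unif) (hcard : 0 < T.card) {x : ℝ}
    (hx : 0 < x) : Measure.pi μ {u | x ≤ maxDeviation T u}
      ≤ ENNReal.ofReal (4 * Real.exp (-x ^ 2 / (2 * T.card))) := by
  have hp1 : ∀ k, unif.real (Set.Iio (gridPoint T.card k)) ≤ 1 / 2 := fun k => by
    rw [unif_real_Iio (gridPoint_nonneg T.card k) ((gridPoint_le T.card k).trans (by norm_num))]
    exact gridPoint_le _ _
  have hp2 : ∀ k, unif.real (Set.Ioi (1 - gridPoint T.card k)) ≤ 1 / 2 := fun k => by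
    rw [unif_real_Ioi (t := 1 - gridPoint T.card k) (by linarith [gridPoint_le T.card k])
      (by linarith [gridPoint_nonneg T.card k]), sub_sub_cancel]
    exact gridPoint_le _ _
  have hm1 : Monotone fun k => Set.Iio (gridPoint T.card k) := fun a b h =>
    Set.Iio_subset_Iio (gridPoint_mono _ h)
  have hm2 : Monotone fun k => Set.Ioi (1 - gridPoint T.card k) := fun a b h =>
    Set.Ioi_subset_Ioi (by linarith [gridPoint_mono T.card h])
  have A := fun σ (hσ : σ ^ 2 = (1 : ℝ)) => measure_exists_le_compensatedSum hT hm1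
    (fun _ => measurableSet_Iio) hp1 T.card hx hcard hσ
  have B := fun σ (hσ : σ ^ 2 = (1 : ℝ)) => measure_exists_le_compensatedSum hT hm2
    (fun _ => measurableSet_Ioi) hp2 T.card hx hcard hσ
  have hsub : {u : κ → ℝ | x ≤ maxDeviation T u} ⊆
      ({u | ∃ k ≤ T.card, x ≤ 1 * compensatedSum unif T (Set.Iio (gridPoint T.card k)) u} ∪
        {u | ∃ k ≤ T.card, x ≤ -1 * compensatedSum unif T (Set.Iio (gridPoint T.card k)) u}) ∪
      ({u | ∃ k ≤ T.card, x ≤ 1 * compensatedSum unif T (Set.Ioi (1 - gridPoint T.card k)) u} ∪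
        {u | ∃ k ≤ T.card,
          x ≤ -1 * compensatedSum unif T (Set.Ioi (1 - gridPoint T.card k)) u}) := by
    intro u hu
    obtain ⟨k, hk, hku⟩ := (Finset.le_sup'_iff Finset.nonempty_range_add_one).1
      (show x ≤ maxDeviation T u from hu)
    have hk' := Nat.le_of_lt_succ (Finset.mem_range.1 hk)
    rcases le_max_iff.1 hku with h | h
    · left
      rcases le_abs.1 h with h | h
      · exact Or.inl ⟨k, hk', by simpa using h⟩
      · exact Or.inr ⟨k, hk', by simpa using h⟩
    · right
      rcases le_abs.1 h with h | h
      · exact Or.inl ⟨k, hk', by simpa using h⟩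
      · exact Or.inr ⟨k, hk', by simpa using h⟩
  refine (measure_mono hsub).trans ?_
  refine (measure_union_le _ _).trans ((add_le_add (measure_union_le _ _)
    (measure_union_le _ _)).trans ((add_le_add (add_le_add (A 1 (by norm_num)) (A (-1) (by norm_num)))
    (add_le_add (B 1 (by norm_num)) (B (-1) (by norm_num)))).trans (le_of_eq ?_)))
  rw [← ENNReal.ofReal_add (Real.exp_pos _).le (Real.exp_pos _).le,
    ← ENNReal.ofReal_add (by positivity) (by positivity)]
  congr 1; ring

lemma lintegral_maxDeviation_le (hT : ∀ i ∈ T, μ i = unif) (hcard : 0 < T.card) :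
    ∫⁻ u, ENNReal.ofReal (maxDeviation T u) ∂(Measure.pi μ)
      ≤ ENNReal.ofReal (2.55 * Real.sqrt T.card) := by
  have hN : (0 : ℝ) < T.card := Nat.cast_pos.2 hcard
  set r := Real.sqrt T.card with hr
  have hr0 : 0 < r := Real.sqrt_pos.2 hN
  have hrr : r ^ 2 = T.card := Real.sq_sqrt hN.le
  -- Layer-cake formula, cut at `2 r`: below, probabilities are at most `1`; above, `t² / (2 r²) ≥ t
  -- / r` turns the Gaussian tail into an integrable exponential. The total is `(2 + 4 e⁻²) r ≤ 2.55
  -- r`.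
  rw [lintegral_eq_lintegral_meas_le _ (ae_of_all _ maxDeviation_nonneg)
    measurable_maxDeviation.aemeasurable,
    ← Set.Ioc_union_Ioi_eq_Ioi (a := (0 : ℝ)) (b := 2 * r) (by positivity),
    lintegral_union measurableSet_Ioi (Set.Ioc_disjoint_Ioi le_rfl)]
  have h1 : ∫⁻ t in Set.Ioc 0 (2 * r), Measure.pi μ {u | t ≤ maxDeviation T u}
      ≤ ENNReal.ofReal (2 * r) := by
    refine (lintegral_mono (g := fun _ => 1) fun t => prob_le_one).trans ?_
    simp
  have h2 : ∫⁻ t in Set.Ioi (2 * r), Measure.pi μ {u | t ≤ maxDeviation T u}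
      ≤ ENNReal.ofReal (4 * (r * Real.exp (-2))) := by
    have hle : ∫⁻ t in Set.Ioi (2 * r), Measure.pi μ {u | t ≤ maxDeviation T u}
        ≤ ∫⁻ t in Set.Ioi (2 * r), ENNReal.ofReal (4 * Real.exp (-r⁻¹ * t)) := by
      refine setLIntegral_mono' measurableSet_Ioi fun t ht => ?_
      have ht' : 2 * r < t := ht
      have ht0 : 0 < t := by linarith
      refine (measure_le_maxDeviation hT hcard ht0).trans (ENNReal.ofReal_le_ofReal ?_)
      gcongr
      rw [neg_div, neg_mul, neg_le_neg_iff, ← hrr, le_div_iff₀ (by positivity)]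
      have : r⁻¹ * t * (2 * r ^ 2) = 2 * r * t := by field_simp
      rw [this, pow_two]
      exact mul_le_mul_of_nonneg_right ht'.le ht0.le
    refine hle.trans ?_
    have hneg : -r⁻¹ < 0 := by simpa using hr0
    rw [← ofReal_integral_eq_lintegral_ofReal
      ((integrableOn_exp_mul_Ioi hneg _).const_mul 4) (ae_of_all _ fun t => by positivity),
      integral_const_mul, integral_exp_mul_Ioi hneg]
    refine ENNReal.ofReal_le_ofReal (le_of_eq ?_)
    have : -r⁻¹ * (2 * r) = -2 := by field_simp
    rw [this]; field_simp
  refine (add_le_add h1 h2).trans ?_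
  rw [← ENNReal.ofReal_add (by positivity) (by positivity)]
  refine ENNReal.ofReal_le_ofReal ?_
  have he : Real.exp (-2) ≤ 0.1375 := by
    have e1 : Real.exp (-2) = (Real.exp 1 ^ 2)⁻¹ := by
      rw [Real.exp_neg, ← Real.exp_nat_mul]; norm_num
    rw [e1]
    have := Real.exp_one_gt_d9
    refine inv_le_of_inv_le₀ (by norm_num) ?_
    nlinarith
  nlinarith

end Uniform

end NormalizingFactors

namespace NormalizingFactors

/-! ### From lower bounds on counts to bounds on the ratios -/

section Deterministic

variable {s : ℕ} {ε : ℝ} {q : Fin s → ℝ}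

lemma count_eq_countIn (q : Fin s → ℝ) (A : Set ℝ) :
    (count q A : ℝ) = countIn Finset.univ q A := by
  classical
  have : {i : Fin s | q i ∈ A} = ↑(Finset.univ.filter fun i => q i ∈ A) := by ext; simp
  rw [count, this, Set.ncard_coe_finset, countIn]
  simp [Set.indicator_apply]

lemma count_mono {A B : Set ℝ} (h : A ⊆ B) : (count q A : ℝ) ≤ count q B := by
  rw [count_eq_countIn, count_eq_countIn]
  exact countIn_mono h q

lemma mem_Icc_of_mem_range_union (hq : ∀ i, q i ∈ Set.Icc (0 : ℝ) 1) {b : ℝ}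
    (hb : b ∈ Set.range q ∪ {0, 1}) : b ∈ Set.Icc (0 : ℝ) 1 := by
  rcases hb with ⟨i, rfl⟩ | rfl | rfl
  · exact hq i
  · simp
  · simp

lemma storey_ratio_le (hq : ∀ i, q i ∈ Set.Icc (0 : ℝ) 1) :
    ∀ x ∈ {x : ℝ | ∃ a ∈ Set.range q ∪ {0, 1}, ∃ b ∈ Set.range q ∪ {0, 1},
      0 ≤ a ∧ a ≤ b - ε ∧ x = (s : ℝ) * (b - a) / max 1 (count q (Set.Ioo a b) : ℝ)}, x ≤ s := by
  rintro x ⟨a, ha, b, hb, h0, hab, rfl⟩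
  have hb1 := (mem_Icc_of_mem_range_union hq hb).2
  have hs : (0 : ℝ) ≤ s := Nat.cast_nonneg s
  rw [div_le_iff₀ (lt_max_of_lt_left one_pos)]
  exact mul_le_mul_of_nonneg_left ((by linarith : b - a ≤ 1).trans (le_max_left _ _)) hs

lemma intervalStoreyMax_le (hq : ∀ i, q i ∈ Set.Icc (0 : ℝ) 1) : intervalStoreyMax ε q ≤ s :=
  Real.sSup_le (storey_ratio_le hq) (Nat.cast_nonneg s)

lemma intervalStoreyMax_nonneg (hε : 0 ≤ ε) : 0 ≤ intervalStoreyMax ε q := by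
  refine Real.sSup_nonneg ?_
  rintro x ⟨a, ha, b, hb, h0, hab, rfl⟩
  exact div_nonneg (mul_nonneg (Nat.cast_nonneg s) (by linarith)) (zero_le_one.trans (le_max_left _ _))

lemma storeyMax_le_intervalStoreyMax (hs : 0 < s) (hε : 0 ≤ ε) (hε1 : ε ≤ 1)
    (hq : ∀ i, q i ∈ Set.Icc (0 : ℝ) 1) : storeyMax ε q ≤ intervalStoreyMax ε q := by
  have hs' : (1 : ℝ) ≤ s := Nat.one_le_cast.2 hs
  have hbdd : BddAbove {x : ℝ | ∃ a ∈ Set.range q ∪ {0, 1}, ∃ b ∈ Set.range q ∪ {0, 1},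
      0 ≤ a ∧ a ≤ b - ε ∧ x = (s : ℝ) * (b - a) / max 1 (count q (Set.Ioo a b) : ℝ)} :=
    ⟨s, storey_ratio_le hq⟩
  refine max_le ?_ (Real.sSup_le ?_ ?_)
  -- The interval `(0, 1)` has ratio at least `1`, its count being at most `s`.
  · refine le_trans ?_ (le_csSup hbdd ⟨0, by simp, 1, by simp, le_rfl, by linarith, rfl⟩)
    rw [le_div_iff₀ (lt_max_of_lt_left one_pos), one_mul, sub_zero, mul_one]
    refine max_le hs' (Nat.cast_le.2 ?_)
    exact (Set.ncard_le_ncard (Set.subset_univ _)).trans (by simp [Set.ncard_univ])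
  · rintro x ⟨lam, ⟨hl, hl0, hl1⟩, rfl⟩
    refine le_trans ?_ (le_csSup hbdd
      ⟨lam, Or.inl hl, 1, by simp, hl0.le, by linarith, rfl⟩)
    refine div_le_div_of_nonneg_left (mul_nonneg (by linarith) ?_) (lt_max_of_lt_left one_pos)
      (max_le_max_left _ (count_mono Set.Ioo_subset_Ioi_self))
    obtain ⟨i, rfl⟩ := hl
    linarith [(hq i).2]
  · exact intervalStoreyMax_nonneg hε

lemma intervalStoreyMax_le_of_le_count (hs : 0 < s) (hε : 0 < ε)
    (hq : ∀ i, q i ∈ Set.Icc (0 : ℝ) 1) {W : ℝ} (hW0 : 0 ≤ W) (hW : W ≤ s * ε / 4)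
    (hcount : ∀ a b, 0 ≤ a → a ≤ b → b ≤ 1 → s * (b - a) - W ≤ count q (Set.Ioo a b)) :
    intervalStoreyMax ε q ≤ 1 + 4 / 3 * (W / (s * ε)) := by
  have hs' : (0 : ℝ) < s := Nat.cast_pos.2 hs
  refine Real.sSup_le ?_ (by positivity)
  rintro x ⟨a, ha, b, hb, h0, hab, rfl⟩
  have hb1 := (mem_Icc_of_mem_range_union hq hb).2
  have hc := hcount a b h0 (by linarith) hb1
  have h1 : s * ε ≤ s * (b - a) := mul_le_mul_of_nonneg_left (by linarith) hs'.le
  have hsε : 0 < s * ε := by positivity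
  have hd : 0 < s * (b - a) - W := by linarith
  calc s * (b - a) / max 1 (count q (Set.Ioo a b) : ℝ)
      ≤ s * (b - a) / (s * (b - a) - W) :=
        div_le_div_of_nonneg_left (by linarith) hd (hc.trans (le_max_right _ _))
    _ = 1 + W / (s * (b - a) - W) := by field_simp; ring
    _ ≤ 1 + W / (3 / 4 * (s * ε)) := by
        gcongr
        linarith
    _ = 1 + 4 / 3 * (W / (s * ε)) := by field_simp

end Deterministic

/-! ### From pointwise bounds to the factors `C` and `D` -/

section Expectation

/-- No measurability of the maxima is needed: a Bochner integral of a non-measurable function is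
`0`, which is below `B`. -/
lemma integral_le_of_lintegral_le {Ω : Type*} [MeasurableSpace Ω] {P : Measure Ω} {f : Ω → ℝ}
    (hf : ∀ ω, 0 ≤ f ω) {B : ℝ} (hB : 0 ≤ B)
    (h : ∫⁻ ω, ENNReal.ofReal (f ω) ∂P ≤ ENNReal.ofReal B) : ∫ ω, f ω ∂P ≤ B := by
  by_cases hm : AEStronglyMeasurable f P
  · rw [integral_eq_lintegral_of_nonneg_ae (ae_of_all _ hf) hm]
    exact ENNReal.toReal_le_of_le_ofReal hB h
  · rwa [integral_non_aestronglyMeasurable hm]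

/-- The two deviations are those of the calibration and test samples; the indicators carry the crude
bound `c` on the events where one of them is large. -/
lemma lintegral_le_of_le_add_indicator {Ω : Type*} [MeasurableSpace Ω] {P : Measure Ω}
    [IsProbabilityMeasure P] {f V₁ V₂ : Ω → ℝ} (hm₁ : Measurable V₁) (hm₂ : Measurable V₂)
    {A α₁ α₂ c x₁ x₂ E₁ E₂ p₁ p₂ : ℝ} (hA : 0 ≤ A) (hα₁ : 0 ≤ α₁) (hα₂ : 0 ≤ α₂) (hc : 0 ≤ c)
    (hE₁ : ∫⁻ ω, ENNReal.ofReal (V₁ ω) ∂P ≤ ENNReal.ofReal E₁)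
    (hE₂ : ∫⁻ ω, ENNReal.ofReal (V₂ ω) ∂P ≤ ENNReal.ofReal E₂)
    (hp₁ : P {ω | x₁ ≤ V₁ ω} ≤ ENNReal.ofReal p₁) (hp₂ : P {ω | x₂ ≤ V₂ ω} ≤ ENNReal.ofReal p₂)
    (h0E₁ : 0 ≤ E₁) (h0E₂ : 0 ≤ E₂) (h0p₁ : 0 ≤ p₁) (h0p₂ : 0 ≤ p₂)
    (hf : ∀ᵐ ω ∂P, f ω ≤ A + α₁ * V₁ ω + α₂ * V₂ ω + {ω | x₁ ≤ V₁ ω}.indicator (fun _ => c) ω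
      + {ω | x₂ ≤ V₂ ω}.indicator (fun _ => c) ω) :
    ∫⁻ ω, ENNReal.ofReal (f ω) ∂P
      ≤ ENNReal.ofReal (A + α₁ * E₁ + α₂ * E₂ + c * p₁ + c * p₂) := by
  have hi : ∀ (S : Set Ω) (ω : Ω), ENNReal.ofReal (S.indicator (fun _ => c) ω)
      = S.indicator (fun _ => ENNReal.ofReal c) ω := by
    intro S ω
    by_cases h : ω ∈ S <;> simp [h]
  have h1 : ∫⁻ ω, ENNReal.ofReal (f ω) ∂P ≤ ∫⁻ ω, (ENNReal.ofReal A
      + ENNReal.ofReal α₁ * ENNReal.ofReal (V₁ ω) + ENNReal.ofReal α₂ * ENNReal.ofReal (V₂ ω)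
      + {ω | x₁ ≤ V₁ ω}.indicator (fun _ => ENNReal.ofReal c) ω
      + {ω | x₂ ≤ V₂ ω}.indicator (fun _ => ENNReal.ofReal c) ω) ∂P := by
    refine lintegral_mono_ae (hf.mono fun ω hω => (ENNReal.ofReal_le_ofReal hω).trans ?_)
    rw [← hi, ← hi, ← ENNReal.ofReal_mul hα₁, ← ENNReal.ofReal_mul hα₂]
    refine ENNReal.ofReal_add_le.trans (add_le_add_left (ENNReal.ofReal_add_le.trans
      (add_le_add_left (ENNReal.ofReal_add_le.trans (add_le_add_left
        ENNReal.ofReal_add_le _)) _)) _)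
  refine h1.trans ?_
  have hS₁ : MeasurableSet {ω | x₁ ≤ V₁ ω} := measurableSet_le measurable_const hm₁
  have hS₂ : MeasurableSet {ω | x₂ ≤ V₂ ω} := measurableSet_le measurable_const hm₂
  rw [lintegral_add_right _ (measurable_const.indicator hS₂),
    lintegral_add_right _ (measurable_const.indicator hS₁),
    lintegral_add_right _ (hm₂.ennreal_ofReal.const_mul _),
    lintegral_add_right _ (hm₁.ennreal_ofReal.const_mul _),
    lintegral_const_mul _ hm₁.ennreal_ofReal, lintegral_const_mul _ hm₂.ennreal_ofReal,
    lintegral_indicator_const hS₁, lintegral_indicator_const hS₂, lintegral_const, measure_univ,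
    mul_one]
  rw [ENNReal.ofReal_add (by positivity) (by positivity),
    ENNReal.ofReal_add (by positivity) (by positivity),
    ENNReal.ofReal_add (by positivity) (by positivity),
    ENNReal.ofReal_add (by positivity) (by positivity),
    ENNReal.ofReal_mul hα₁, ENNReal.ofReal_mul hα₂, ENNReal.ofReal_mul hc, ENNReal.ofReal_mul hc]
  gcongr

/-- Bounds on the factors `C` and `D` follow from bounds on `d(s, ε)`. -/
lemma max_factor_le {Q : (s : ℕ) → Measure (Fin s → ℝ)} {m : ℕ} {ε π₀ B : ℝ} (hε : 0 ≤ ε)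
    (hε1 : ε ≤ 1) (hm : 0 < m) (hπ₀ : 0 < π₀) (hB : 0 ≤ B)
    (hQ : ∀ s : ℕ, π₀ * m ≤ s → s ≤ m → ∀ᵐ q ∂(Q s), ∀ i, q i ∈ Set.Icc (0 : ℝ) 1)
    (h : ∀ s : ℕ, π₀ * m ≤ s → s ≤ m →
      ∫⁻ q, ENNReal.ofReal (intervalStoreyMax ε q) ∂(Q s) ≤ ENNReal.ofReal B) :
    max (factorC Q m ε π₀) (factorD Q m ε π₀) ≤ B := by
  refine max_le (Real.sSup_le ?_ hB) (Real.sSup_le ?_ hB)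
  · rintro x ⟨s, ⟨hs1, hs2⟩, rfl⟩
    have hs : 0 < s := by
      have : (0 : ℝ) < s := lt_of_lt_of_le (mul_pos hπ₀ (Nat.cast_pos.2 hm)) hs1
      exact_mod_cast this
    refine integral_le_of_lintegral_le (fun q => zero_le_one.trans (le_max_left _ _)) hB
      (le_trans (lintegral_mono_ae ((hQ s hs1 hs2).mono fun q hq => ENNReal.ofReal_le_ofReal ?_))
        (h s hs1 hs2))
    exact storeyMax_le_intervalStoreyMax hs hε hε1 hq
  · rintro x ⟨s, ⟨hs1, hs2⟩, rfl⟩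
    exact integral_le_of_lintegral_le (fun q => intervalStoreyMax_nonneg hε) hB (h s hs1 hs2)

end Expectation

/-! ### The independent law -/

section Independent

instance (s : ℕ) (i : Fin s) :
    IsProbabilityMeasure (if (i : ℕ) = 0 then Measure.dirac (0 : ℝ) else unif) := by
  split_ifs <;> infer_instance

instance (s : ℕ) : IsProbabilityMeasure (lawIndep s) := by
  unfold lawIndep; infer_instance

lemma ae_unif_mem_Icc : ∀ᵐ x ∂unif, x ∈ Set.Icc (0 : ℝ) 1 :=
  (ae_restrict_mem measurableSet_Ioo).mono fun _ hx => Set.Ioo_subset_Icc_self hx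

lemma ae_lawIndep_mem_Icc (s : ℕ) : ∀ᵐ q ∂(lawIndep s), ∀ i, q i ∈ Set.Icc (0 : ℝ) 1 := by
  refine ae_all_iff.2 fun i => ?_
  refine (measurePreserving_eval (fun i : Fin s =>
    if (i : ℕ) = 0 then Measure.dirac (0 : ℝ) else unif) i).quasiMeasurePreserving.ae
    (p := fun x => x ∈ Set.Icc (0 : ℝ) 1) ?_
  split_ifs
  · exact (ae_dirac_iff (a := (0 : ℝ)) measurableSet_Icc).2 (by simp)
  · exact ae_unif_mem_Icc

/-- The indices of the coordinates other than the first. -/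
def tailIndices (s : ℕ) : Finset (Fin s) := Finset.univ.filter fun i => (i : ℕ) ≠ 0

lemma card_tailIndices {s : ℕ} (hs : 0 < s) : ((tailIndices s).card : ℝ) = s - 1 := by
  have : tailIndices s = Finset.univ.erase ⟨0, hs⟩ := by
    ext i; simp [tailIndices, Fin.ext_iff]
  rw [this, Finset.card_erase_of_mem (Finset.mem_univ _), Finset.card_univ, Fintype.card_fin,
    Nat.cast_pred hs]

lemma card_tailIndices_pos {s : ℕ} (hs : 2 ≤ s) : 0 < (tailIndices s).card := by
  have h1 := card_tailIndices (s := s) (by omega)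
  have h2 : (2 : ℝ) ≤ s := by exact_mod_cast hs
  have h3 : (0 : ℝ) < (tailIndices s).card := by linarith
  exact_mod_cast h3

/-- The deterministic first coordinate is dropped, at a cost of at most `b - a ≤ 1`: hence `3`
instead of `2`. -/
lemma le_count_of_independent {s : ℕ} (hs : 2 ≤ s) (q : Fin s → ℝ) {a b : ℝ} (h0 : 0 ≤ a)
    (hab : a ≤ b) (h1 : b ≤ 1) :
    s * (b - a) - (2 * maxDeviation (tailIndices s) q + 3) ≤ count q (Set.Ioo a b) := by
  have h := le_countIn_Ioo (card_tailIndices_pos hs) h0 hab h1 q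
  rw [card_tailIndices (by omega)] at h
  have h2 : countIn (tailIndices s) q (Set.Ioo a b) ≤ count q (Set.Ioo a b) := by
    rw [count_eq_countIn]
    exact Finset.sum_le_sum_of_subset_of_nonneg (Finset.subset_univ _)
      fun _ _ _ => Set.indicator_nonneg (fun _ _ => zero_le_one) _
  linarith

lemma lintegral_intervalStoreyMax_lawIndep_le {s : ℕ} {ε : ℝ} (hε : 0 < ε) (hs : 2 ≤ s)
    (hsε : 24 ≤ s * ε) :
    ∫⁻ q, ENNReal.ofReal (intervalStoreyMax ε q) ∂(lawIndep s)
      ≤ ENNReal.ofReal (1 + 4 / (s * ε) + 6.8 * Real.sqrt s / (s * ε)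
        + 4 * s * Real.exp (-(s * ε ^ 2) / 512)) := by
  have hs0 : (2 : ℝ) ≤ s := by exact_mod_cast hs
  have hT : ∀ i ∈ tailIndices s,
      (if (i : ℕ) = 0 then Measure.dirac (0 : ℝ) else unif) = unif := fun i hi =>
    if_neg (Finset.mem_filter.1 hi).2
  have hcard := card_tailIndices_pos hs
  have hcard' := card_tailIndices (s := s) (by omega)
  -- Below this threshold `W = 2 V + 3 ≤ s ε / 8 + 3 ≤ s ε / 4`, as `s ε ≥ 24`.
  have hx : 0 < s * ε / 16 := by positivity
  have hE := lintegral_maxDeviation_le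
    (μ := fun i : Fin s => if (i : ℕ) = 0 then Measure.dirac (0 : ℝ) else unif) hT hcard
  have hp := measure_le_maxDeviation
    (μ := fun i : Fin s => if (i : ℕ) = 0 then Measure.dirac (0 : ℝ) else unif) hT hcard hx
  rw [hcard'] at hE hp
  have hmain := lintegral_le_of_le_add_indicator (P := lawIndep s) (f := intervalStoreyMax ε)
    -- There is only one sample: the second deviation is `0` and its event `1 ≤ 0` is empty.
    (V₁ := maxDeviation (tailIndices s)) (V₂ := 0) (A := 1 + 4 / (s * ε))
    (α₁ := 4 / 3 * 2 / (s * ε)) (α₂ := 0) (c := s) (x₂ := 1) (E₂ := 0) (p₂ := 0)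
    measurable_maxDeviation measurable_zero (by positivity) (by positivity) le_rfl (by positivity)
    hE (by simp) hp (by simp [not_le.2 (zero_lt_one' ℝ)]) (by positivity) le_rfl (by positivity) le_rfl ?_
  · refine hmain.trans (ENNReal.ofReal_le_ofReal ?_)
    have e1 : Real.sqrt (s - 1) ≤ Real.sqrt s := Real.sqrt_le_sqrt (by linarith)
    have e2 : 4 / 3 * 2 / (s * ε) * (2.55 * Real.sqrt (s - 1)) ≤ 6.8 * Real.sqrt s / (s * ε) := by
      rw [div_mul_eq_mul_div]
      exact div_le_div_of_nonneg_right (by linarith) (by positivity)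
    have e3 : Real.exp (-(s * ε / 16) ^ 2 / (2 * (s - 1))) ≤ Real.exp (-(s * ε ^ 2) / 512) := by
      refine Real.exp_le_exp.2 ?_
      rw [neg_div, neg_div, neg_le_neg_iff, div_le_div_iff₀ (by norm_num) (by linarith)]
      have : 0 ≤ s * ε ^ 2 := by positivity
      nlinarith
    have e4 : (s : ℝ) * (4 * Real.exp (-(s * ε / 16) ^ 2 / (2 * (s - 1))))
        ≤ 4 * s * Real.exp (-(s * ε ^ 2) / 512) := by
      rw [mul_left_comm, ← mul_assoc]
      gcongr
    linarith
  · filter_upwards [ae_lawIndep_mem_Icc s] with q hq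
    have hV := maxDeviation_nonneg (T := tailIndices s) q
    have hempty : {ω : Fin s → ℝ | (1 : ℝ) ≤ (0 : (Fin s → ℝ) → ℝ) ω} = ∅ := by
      ext; simp
    rw [hempty, Set.indicator_empty]
    by_cases hW : s * ε / 16 ≤ maxDeviation (tailIndices s) q
    · rw [Set.indicator_of_mem (show q ∈ {ω | s * ε / 16 ≤ maxDeviation (tailIndices s) ω} from hW)]
      have := intervalStoreyMax_le (ε := ε) hq
      have h3 : 0 ≤ 4 / 3 * 2 / (s * ε) * maxDeviation (tailIndices s) q := by positivity
      have h4 : 0 ≤ 4 / (s * ε) := by positivity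
      linarith
    · rw [Set.indicator_of_notMem
        (show q ∉ {ω | s * ε / 16 ≤ maxDeviation (tailIndices s) ω} from hW)]
      refine (intervalStoreyMax_le_of_le_count (by omega) hε hq
        (W := 2 * maxDeviation (tailIndices s) q + 3) (by positivity) (by linarith)
        fun a b h0 hab h1 => le_count_of_independent hs q h0 hab h1).trans (le_of_eq ?_)
      simp only [add_zero, zero_mul]
      field_simp
      ring

end Independent

end NormalizingFactors

namespace NormalizingFactors

/-! ### The conformal law -/

section Conformal

variable {n s : ℕ}

lemma sum_ite_ge_eq_countIn (S : Fin n ⊕ Fin s → ℝ) (x : ℝ) [∀ k, Decidable (S (Sum.inl k) ≥ x)] :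
    (∑ k : Fin n, if S (Sum.inl k) ≥ x then (1 : ℝ) else 0)
      = countIn (Finset.univ.map Function.Embedding.inl) S (Set.Ici x) := by
  rw [countIn, Finset.sum_map]
  refine Finset.sum_congr rfl fun k _ => ?_
  by_cases h : x ≤ S (Sum.inl k) <;> simp [h]

lemma modifiedPValue_mem_Icc (S : Fin n ⊕ Fin s → ℝ) (i j : Fin s) :
    modifiedPValue S i j ∈ Set.Icc (0 : ℝ) 1 := by
  have hn : (0 : ℝ) < (n : ℝ) + 1 := by positivity
  unfold modifiedPValue
  by_cases hj : j = i
  · simp [hj]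
  rw [if_neg hj]
  constructor
  · refine div_nonneg (add_nonneg (Finset.sum_nonneg fun k _ => ?_) ?_) hn.le <;>
      split_ifs <;> norm_num
  · rw [div_le_one hn]
    refine add_le_add ((Finset.sum_le_card_nsmul _ _ 1 fun k _ => ?_).trans (by simp)) ?_ <;>
      split_ifs <;> norm_num

/-- A conformal `p`-value is close to the upper tail probability of its score. -/
lemma abs_modifiedPValue_sub_le (hn : 0 < n) (S : Fin n ⊕ Fin s → ℝ) {i j : Fin s} (hj : j ≠ i)
    (hS : S (Sum.inr j) ∈ Set.Icc (0 : ℝ) 1) :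
    |modifiedPValue S i j - (1 - S (Sum.inr j))|
      ≤ (maxDeviation (Finset.univ.map Function.Embedding.inl : Finset (Fin n ⊕ Fin s)) S + 2)
        / (n + 1) := by
  classical
  have hn' : (0 : ℝ) < (n : ℝ) + 1 := by positivity
  set T : Finset (Fin n ⊕ Fin s) := Finset.univ.map Function.Embedding.inl with hT
  have hcard : T.card = n := by simp [hT]
  have hcard0 : 0 < T.card := hn.trans_eq hcard.symm
  set x := S (Sum.inr j) with hx
  have h1 := le_countIn_Iio hcard0 hS.1 hS.2 S
  have h2 := countIn_Iic_le hcard0 hS.1 hS.2 S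
  have h3 := countIn_add_countIn_compl (T := T) (Set.Iio x) S
  have h4 : countIn T S (Set.Iio x) ≤ countIn T S (Set.Iic x) := countIn_mono Set.Iio_subset_Iic_self S
  rw [Set.compl_Iio] at h3
  rw [hcard] at h1 h2 h3
  unfold modifiedPValue
  rw [if_neg hj, sum_ite_ge_eq_countIn S x, ← hT, div_sub' hn'.ne', abs_div, abs_of_pos hn']
  refine div_le_div_of_nonneg_right (abs_le.2 ?_) hn'.le
  -- The calibration count errs by at most `V + 1` around `n (1 - x)`; this extra score adds at most
  -- `1` to the error.
  have h5 : (0 : ℝ) ≤ (if S (Sum.inr i) ≥ x then (1 : ℝ) else 0) ∧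
      (if S (Sum.inr i) ≥ x then (1 : ℝ) else 0) ≤ 1 := by split_ifs <;> norm_num
  constructor <;> linarith [h5.1, h5.2, hS.1, hS.2]

/-- With `Δ` the uniform error of the `p`-values, test scores in `(1 - b + Δ, 1 - a - Δ)` have their
`p`-value in `(a, b)`. The lost length `2 Δ` costs `2 s Δ` in the count; if `b - a ≤ 2 Δ`, the lower
bound is nonpositive. -/
lemma le_count_of_conformal (hn : 0 < n) (hs : 2 ≤ s) (S : Fin n ⊕ Fin s → ℝ) (i₀ : Fin s)
    (hi₀ : (i₀ : ℕ) = 0) {a b : ℝ} (h0 : 0 ≤ a) (h1 : b ≤ 1) :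
    s * (b - a) - (2 * maxDeviation ((tailIndices s).map Function.Embedding.inr) S + 3
        + 2 * s * ((maxDeviation (Finset.univ.map Function.Embedding.inl) S + 2) / (n + 1)))
      ≤ count (modifiedPValue S i₀) (Set.Ioo a b) := by
  have hs0 : (2 : ℝ) ≤ s := by exact_mod_cast hs
  set V₁ := maxDeviation (Finset.univ.map Function.Embedding.inl : Finset (Fin n ⊕ Fin s)) S
    with hV₁
  set T : Finset (Fin n ⊕ Fin s) := (tailIndices s).map Function.Embedding.inr with hT
  set V₂ := maxDeviation T S with hV₂
  have hV₁0 : 0 ≤ V₁ := maxDeviation_nonneg _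
  have hV₂0 : 0 ≤ V₂ := maxDeviation_nonneg _
  set Δ := (V₁ + 2) / ((n : ℝ) + 1) with hΔ
  have hΔ0 : 0 ≤ Δ := by positivity
  rcases le_or_gt (b - a - 2 * Δ) 0 with hneg | hpos
  · refine le_trans ?_ (Nat.cast_nonneg _)
    nlinarith
  have hcard : T.card = (tailIndices s).card := Finset.card_map _
  have hcard0 : 0 < T.card := hcard ▸ card_tailIndices_pos hs
  have h := le_countIn_Ioo hcard0 (a := 1 - b + Δ) (b := 1 - a - Δ) (by linarith) (by linarith)
    (by linarith) S
  rw [hcard, card_tailIndices (by omega), ← hV₂] at h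
  have h2 : countIn T S (Set.Ioo (1 - b + Δ) (1 - a - Δ))
      ≤ count (modifiedPValue S i₀) (Set.Ioo a b) := by
    rw [count_eq_countIn, countIn, hT, Finset.sum_map]
    refine (Finset.sum_le_sum fun j hj => ?_).trans (Finset.sum_le_sum_of_subset_of_nonneg
      (Finset.subset_univ (tailIndices s))
      fun _ _ _ => Set.indicator_nonneg (fun _ _ => zero_le_one) _)
    have hji : j ≠ i₀ := fun h => (Finset.mem_filter.1 hj).2 (h ▸ hi₀)
    by_cases hm : S (Sum.inr j) ∈ Set.Ioo (1 - b + Δ) (1 - a - Δ)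
    · have hp := abs_le.1 (abs_modifiedPValue_sub_le hn S hji
        ⟨by linarith [hm.1], by linarith [hm.2]⟩)
      rw [← hV₁, ← hΔ] at hp
      have hm' : modifiedPValue S i₀ j ∈ Set.Ioo a b :=
        ⟨by linarith [hp.1, hm.2], by linarith [hp.2, hm.1]⟩
      rw [Set.indicator_of_mem hm']
      exact Set.indicator_le_self' (fun _ _ => zero_le_one) _
    · rw [Function.Embedding.inr_apply, Set.indicator_of_notMem hm]
      exact Set.indicator_nonneg (fun _ _ => zero_le_one) _
  nlinarith

lemma ae_lawConf_mem_Icc (n s : ℕ) : ∀ᵐ q ∂(lawConf n s), ∀ i, q i ∈ Set.Icc (0 : ℝ) 1 := by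
  unfold lawConf
  by_cases hm : AEMeasurable (fun (S : Fin n ⊕ Fin s → ℝ) (j : Fin s) =>
      modifiedPValue S ⟨0, j.pos⟩ j) (Measure.pi fun _ : Fin n ⊕ Fin s => unif)
  · refine ae_all_iff.2 fun i => (ae_map_iff hm ?_).2 (ae_of_all _ fun S =>
      modifiedPValue_mem_Icc S _ i)
    exact measurable_pi_apply i measurableSet_Icc
  -- The pushforward would then be the zero measure.
  · rw [Measure.map_of_not_aemeasurable hm]
    simp

lemma lintegral_intervalStoreyMax_lawConf_le {ε : ℝ} (hε : 0 < ε) (hs : 2 ≤ s) (hn : 0 < n)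
    (hsε : 48 ≤ s * ε) (hnε : 64 ≤ n * ε) :
    ∫⁻ q, ENNReal.ofReal (intervalStoreyMax ε q) ∂(lawConf n s)
      ≤ ENNReal.ofReal (1 + (4 / (s * ε) + 16 / (3 * (n * ε)))
        + 6.8 * Real.sqrt n / (n * ε) + 6.8 * Real.sqrt s / (s * ε)
        + 4 * s * Real.exp (-(n * ε ^ 2) / 2048) + 4 * s * Real.exp (-(s * ε ^ 2) / 2048)) := by
  have hs0 : (2 : ℝ) ≤ s := by exact_mod_cast hs
  have hn0 : (0 : ℝ) < n := Nat.cast_pos.2 hn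
  set T₁ : Finset (Fin n ⊕ Fin s) := Finset.univ.map Function.Embedding.inl with hT₁
  set T₂ : Finset (Fin n ⊕ Fin s) := (tailIndices s).map Function.Embedding.inr with hT₂
  have hcard₁ : T₁.card = n := by simp [hT₁]
  have hcard₂ : (T₂.card : ℝ) = s - 1 := by
    rw [hT₂, Finset.card_map, card_tailIndices (by omega)]
  have hpos₂ : 0 < T₂.card := by
    rw [hT₂, Finset.card_map]; exact card_tailIndices_pos hs
  have hE₁ := lintegral_maxDeviation_le (μ := fun _ : Fin n ⊕ Fin s => unif) (T := T₁)
    (fun _ _ => rfl) (hn.trans_eq hcard₁.symm)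
  have hE₂ := lintegral_maxDeviation_le (μ := fun _ : Fin n ⊕ Fin s => unif) (T := T₂)
    (fun _ _ => rfl) hpos₂
  -- The thresholds split `s ε / 4` equally: with `n ε ≥ 64` the calibration part `2 s Δ` is at most
  -- `s ε / 8`, and with `s ε ≥ 48` so is `2 V₂ + 3`.
  have hp₁ := measure_le_maxDeviation (μ := fun _ : Fin n ⊕ Fin s => unif) (T := T₁)
    (fun _ _ => rfl) (hn.trans_eq hcard₁.symm) (x := n * ε / 32) (by positivity)
  have hp₂ := measure_le_maxDeviation (μ := fun _ : Fin n ⊕ Fin s => unif) (T := T₂)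
    (fun _ _ => rfl) hpos₂ (x := s * ε / 32) (by positivity)
  rw [hcard₁] at hE₁ hp₁
  rw [hcard₂] at hE₂ hp₂
  refine (lintegral_map_le _ _).trans ?_
  refine (lintegral_le_of_le_add_indicator (V₁ := maxDeviation T₁) (V₂ := maxDeviation T₂)
    (A := 1 + (4 / (s * ε) + 16 / (3 * (n * ε))))
    (α₁ := 4 / 3 * 2 / (n * ε)) (α₂ := 4 / 3 * 2 / (s * ε)) (c := s)
    measurable_maxDeviation measurable_maxDeviation (by positivity) (by positivity)
    (by positivity) (by positivity) hE₁ hE₂ hp₁ hp₂ (by positivity) (by positivity)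
    (by positivity) (by positivity) (ae_of_all _ fun S => ?_)).trans
    (ENNReal.ofReal_le_ofReal ?_)
  · have hq : ∀ j : Fin s, (fun j => modifiedPValue S ⟨0, j.pos⟩ j) j ∈ Set.Icc (0 : ℝ) 1 :=
      fun j => modifiedPValue_mem_Icc S _ j
    have hV₁ := maxDeviation_nonneg (T := T₁) S
    have hV₂ := maxDeviation_nonneg (T := T₂) S
    have hi₁ : 0 ≤ {S | n * ε / 32 ≤ maxDeviation T₁ S}.indicator (fun _ => (s : ℝ)) S :=
      Set.indicator_nonneg (fun _ _ => by positivity) _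
    have hi₂ : 0 ≤ {S | s * ε / 32 ≤ maxDeviation T₂ S}.indicator (fun _ => (s : ℝ)) S :=
      Set.indicator_nonneg (fun _ _ => by positivity) _
    have hA : 0 ≤ 4 / (s * ε) + 16 / (3 * (n * ε)) := by positivity
    have ht₁ : 0 ≤ 4 / 3 * 2 / (n * ε) * maxDeviation T₁ S := by positivity
    have ht₂ : 0 ≤ 4 / 3 * 2 / (s * ε) * maxDeviation T₂ S := by positivity
    have hmax := intervalStoreyMax_le (ε := ε) hq
    by_cases hW₁ : n * ε / 32 ≤ maxDeviation T₁ S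
    · rw [Set.indicator_of_mem (show S ∈ {S | n * ε / 32 ≤ maxDeviation T₁ S} from hW₁)]
      linarith
    by_cases hW₂ : s * ε / 32 ≤ maxDeviation T₂ S
    · rw [Set.indicator_of_mem (show S ∈ {S | s * ε / 32 ≤ maxDeviation T₂ S} from hW₂)]
      linarith
    refine le_trans ?_ (le_add_of_nonneg_right hi₂)
    refine le_trans ?_ (le_add_of_nonneg_right hi₁)
    have hΔ : (maxDeviation T₁ S + 2) / ((n : ℝ) + 1) ≤ (maxDeviation T₁ S + 2) / n := by
      gcongr; linarith
    have hΔε : (maxDeviation T₁ S + 2) / n ≤ ε / 16 := by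
      rw [div_le_iff₀ hn0]; linarith
    have hi₀ : (⟨0, by omega⟩ : Fin s).val = 0 := rfl
    refine (intervalStoreyMax_le_of_le_count (by omega) hε hq
      (W := 2 * maxDeviation T₂ S + 3 + 2 * s * ((maxDeviation T₁ S + 2) / (n + 1)))
      (by positivity) ?_ fun a b h0 hab h1 =>
        le_count_of_conformal hn hs S ⟨0, by omega⟩ hi₀ h0 h1).trans ?_
    · nlinarith
    · have h1 : 2 * s * ((maxDeviation T₁ S + 2) / (n + 1))
          ≤ 2 * s * ((maxDeviation T₁ S + 2) / n) := by gcongr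
      have h2 : 4 / 3 * ((2 * maxDeviation T₂ S + 3 + 2 * s * ((maxDeviation T₁ S + 2) / (n + 1)))
          / (s * ε)) ≤ 4 / 3 * ((2 * maxDeviation T₂ S + 3
            + 2 * s * ((maxDeviation T₁ S + 2) / n)) / (s * ε)) := by gcongr
      refine (add_le_add_right h2 1).trans (le_of_eq ?_)
      field_simp
      ring
  · have e1 : Real.sqrt (s - 1) ≤ Real.sqrt s := Real.sqrt_le_sqrt (by linarith)
    have e2 : 4 / 3 * 2 / (s * ε) * (2.55 * Real.sqrt (s - 1)) ≤ 6.8 * Real.sqrt s / (s * ε) := by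
      rw [div_mul_eq_mul_div]
      exact div_le_div_of_nonneg_right (by linarith) (by positivity)
    have e2' : 4 / 3 * 2 / (n * ε) * (2.55 * Real.sqrt n) = 6.8 * Real.sqrt n / (n * ε) := by
      rw [div_mul_eq_mul_div]
      congr 1
      ring
    have e3 : Real.exp (-(s * ε / 32) ^ 2 / (2 * (s - 1))) ≤ Real.exp (-(s * ε ^ 2) / 2048) := by
      refine Real.exp_le_exp.2 ?_
      rw [neg_div, neg_div, neg_le_neg_iff, div_le_div_iff₀ (by norm_num) (by linarith)]
      have : 0 ≤ s * ε ^ 2 := by positivity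
      nlinarith
    have e3' : -(n * ε / 32) ^ 2 / (2 * n) = -(n * ε ^ 2) / 2048 := by
      field_simp
      norm_num
    have e4 : (s : ℝ) * (4 * Real.exp (-(s * ε / 32) ^ 2 / (2 * (s - 1))))
        ≤ 4 * s * Real.exp (-(s * ε ^ 2) / 2048) := by
      rw [mul_left_comm, ← mul_assoc]
      gcongr
    rw [e2', e3']
    linarith

end Conformal

end NormalizingFactors

namespace NormalizingFactors

/-! ### Comparison of all error terms with `1 / (√L ε)` -/

section Asymptotic

lemma one_le_log_natCast {m : ℕ} (hm : 3 ≤ m) : 1 ≤ Real.log m := by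
  have hm' : (3 : ℝ) ≤ m := by exact_mod_cast hm
  rw [Real.le_log_iff_exp_le (by linarith)]
  linarith [Real.exp_one_lt_d9]

/-- The exponential is at most `m⁻³`, and `4 m⁻² ≤ m^(-1/2)` once `m ≥ 3`. -/
lemma exp_tail_le {m s : ℕ} (hm : 3 ≤ m) (hsm : s ≤ m) {y : ℝ} (hy : 3 * Real.log m ≤ y) :
    4 * s * Real.exp (-y) ≤ 1 / Real.sqrt m := by
  have hm' : (3 : ℝ) ≤ m := by exact_mod_cast hm
  have hsm' : (s : ℝ) ≤ m := by exact_mod_cast hsm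
  have h1 : Real.exp (-y) ≤ ((m : ℝ) ^ 3)⁻¹ := by
    refine (Real.exp_le_exp.2 (neg_le_neg hy)).trans (le_of_eq ?_)
    rw [Real.exp_neg, ← Real.exp_log (show (0 : ℝ) < m ^ 3 by positivity), Real.log_pow]
    norm_num
  set r := Real.sqrt m with hr
  have hr0 : 0 < r := Real.sqrt_pos.2 (by linarith)
  have hrr : r ^ 2 = m := Real.sq_sqrt (by linarith)
  calc 4 * s * Real.exp (-y) ≤ 4 * m * ((m : ℝ) ^ 3)⁻¹ := by gcongr
    _ ≤ 1 / r := by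
      rw [← hrr] at hm' ⊢
      rw [← div_eq_mul_inv, div_le_div_iff₀ (by positivity) hr0]
      have h3 : 4 ≤ r ^ 3 := by nlinarith
      have h4 : (0 : ℝ) ≤ r ^ 3 := by positivity
      nlinarith

lemma sqrt_div_mul_le {L x ε : ℝ} (hL : 0 < L) (hLx : L ≤ x) (hε : 0 < ε) :
    Real.sqrt x / (x * ε) ≤ 1 / (Real.sqrt L * ε) := by
  have hx : 0 < Real.sqrt x := Real.sqrt_pos.2 (hL.trans_le hLx)
  have e : Real.sqrt x / (x * ε) = 1 / (Real.sqrt x * ε) := by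
    nth_rewrite 2 [← Real.mul_self_sqrt (hL.trans_le hLx).le]
    field_simp
  have hL' := Real.sqrt_pos.2 hL
  rw [e]
  gcongr

lemma four_div_mul_le {L x ε : ℝ} (hL : 0 < L) (hLx : L ≤ x) (hx : 16 ≤ x) (hε : 0 < ε) :
    4 / (x * ε) ≤ 1 / (Real.sqrt L * ε) := by
  refine le_trans ?_ (sqrt_div_mul_le hL hLx hε)
  gcongr
  exact Real.le_sqrt_of_sq_le (by linarith)

lemma one_div_sqrt_le {L ε m : ℝ} (hL : 0 < L) (hLm : L ≤ m) (hε : 0 < ε) (hε1 : ε ≤ 1) :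
    1 / Real.sqrt m ≤ 1 / (Real.sqrt L * ε) := by
  have hL' := Real.sqrt_pos.2 hL
  refine one_div_le_one_div_of_le (by positivity) ?_
  exact (mul_le_of_le_one_right hL'.le hε1).trans (Real.sqrt_le_sqrt hLm)

lemma max_factor_lawIndep_sub_one_le {m : ℕ} {ε π₀ : ℝ} (hm : 3 ≤ m) (hε : ε ∈ Set.Ioo (0 : ℝ) 1)
    (hπ₀ : π₀ ∈ Set.Ioo (0 : ℝ) 1) (h : 10000 * Real.log m ≤ m * π₀ * ε ^ 2) :
    max (factorC lawIndep m ε π₀) (factorD lawIndep m ε π₀) - 1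
      ≤ 9 / (Real.sqrt (m * π₀) * ε) := by
  obtain ⟨hε0, hε1⟩ := hε
  have hm' : (3 : ℝ) ≤ m := by exact_mod_cast hm
  have hL : 0 < m * π₀ := mul_pos (by linarith) hπ₀.1
  have hlog := one_le_log_natCast hm
  have hR : 9 / (Real.sqrt (m * π₀) * ε) = 9 * (1 / (Real.sqrt (m * π₀) * ε)) := by ring
  have hR0 : 0 ≤ 1 / (Real.sqrt (m * π₀) * ε) := by positivity
  rw [sub_le_iff_le_add, hR]
  refine max_factor_le hε0.le hε1.le (by omega) hπ₀.1 (by positivity)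
    (fun s _ _ => ae_lawIndep_mem_Icc s) fun s hs1 hs2 => ?_
  have hLs : m * π₀ ≤ s := by linarith
  have hε2 : ε ^ 2 ≤ ε := by nlinarith
  have hsε2 : 10000 * Real.log m ≤ s * ε ^ 2 :=
    h.trans (mul_le_mul_of_nonneg_right hLs (by positivity))
  have hsε : (10000 : ℝ) ≤ s * ε := by
    have := mul_le_mul_of_nonneg_left hε2 (Nat.cast_nonneg (α := ℝ) s)
    linarith
  have hs : (10000 : ℝ) ≤ s := by
    have := mul_le_of_le_one_right (Nat.cast_nonneg (α := ℝ) s) hε1.le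
    linarith
  have hs' : 2 ≤ s := by
    have : (2 : ℝ) ≤ s := by linarith
    exact_mod_cast this
  refine (lintegral_intervalStoreyMax_lawIndep_le hε0 hs' (by linarith)).trans
    (ENNReal.ofReal_le_ofReal ?_)
  have t1 := four_div_mul_le hL hLs (by linarith) hε0
  have t2 := sqrt_div_mul_le hL hLs hε0
  have t3 := (exp_tail_le hm hs2 (y := s * ε ^ 2 / 512) (by linarith)).trans
    (one_div_sqrt_le hL (mul_le_of_le_one_right (by linarith) hπ₀.2.le) hε0 hε1.le)
  rw [← neg_div] at t3
  rw [mul_div_assoc]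
  -- In units of `1 / (√(m π₀) ε)` the terms add up to `1 + 6.8 + 1 ≤ 9`.
  linarith

lemma max_factor_lawConf_sub_one_le {m n : ℕ} {ε π₀ : ℝ} (hm : 3 ≤ m) (hn : 0 < n)
    (hε : ε ∈ Set.Ioo (0 : ℝ) 1) (hπ₀ : π₀ ∈ Set.Ioo (0 : ℝ) 1)
    (h : 10000 * Real.log m ≤ min (n : ℝ) m * π₀ * ε ^ 2) :
    max (factorC (lawConf n) m ε π₀) (factorD (lawConf n) m ε π₀) - 1
      ≤ 18 / (Real.sqrt (min (n : ℝ) m * π₀) * ε) := by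
  obtain ⟨hε0, hε1⟩ := hε
  have hm' : (3 : ℝ) ≤ m := by exact_mod_cast hm
  have hn' : (0 : ℝ) < n := Nat.cast_pos.2 hn
  have hmin : 0 < min (n : ℝ) m := lt_min hn' (by linarith)
  set L := min (n : ℝ) m * π₀ with hLdef
  have hL : 0 < L := mul_pos hmin hπ₀.1
  have hLmin : L ≤ min (n : ℝ) m := mul_le_of_le_one_right hmin.le hπ₀.2.le
  have hLn : L ≤ n := hLmin.trans (min_le_left _ _)
  have hlog := one_le_log_natCast hm
  have hR : 18 / (Real.sqrt L * ε) = 18 * (1 / (Real.sqrt L * ε)) := by ring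
  have hR0 : 0 ≤ 1 / (Real.sqrt L * ε) := by positivity
  rw [sub_le_iff_le_add, hR]
  refine max_factor_le hε0.le hε1.le (by omega) hπ₀.1 (by positivity)
    (fun s _ _ => ae_lawConf_mem_Icc n s) fun s hs1 hs2 => ?_
  have hLs : L ≤ s := by
    have := mul_le_mul_of_nonneg_right (min_le_right (n : ℝ) m) hπ₀.1.le
    linarith
  have hε2 : ε ^ 2 ≤ ε := by nlinarith
  have large : ∀ x : ℝ, L ≤ x → 10000 * Real.log m ≤ x * ε ^ 2 ∧ 10000 ≤ x * ε ∧ 10000 ≤ x := by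
    intro x hx
    have h1 : 10000 * Real.log m ≤ x * ε ^ 2 :=
      h.trans (mul_le_mul_of_nonneg_right hx (by positivity))
    have h2 := mul_le_mul_of_nonneg_left hε2 (hL.le.trans hx)
    have h3 := mul_le_of_le_one_right (hL.le.trans hx) hε1.le
    exact ⟨h1, by linarith, by linarith⟩
  obtain ⟨hs_sq, hsε, hs⟩ := large s hLs
  obtain ⟨hn_sq, hnε, hn_large⟩ := large n hLn
  have hs' : 2 ≤ s := by
    have : (2 : ℝ) ≤ s := by linarith
    exact_mod_cast this
  refine (lintegral_intervalStoreyMax_lawConf_le hε0 hs' hn (by linarith) (by linarith)).trans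
    (ENNReal.ofReal_le_ofReal ?_)
  have t1 := four_div_mul_le hL hLs (by linarith) hε0
  have t1' := four_div_mul_le hL hLn (by linarith) hε0
  have t2 := sqrt_div_mul_le hL hLs hε0
  have t2' := sqrt_div_mul_le hL hLn hε0
  have tm := one_div_sqrt_le hL (hLmin.trans (min_le_right _ _)) hε0 hε1.le
  have t3 := (exp_tail_le hm hs2 (y := s * ε ^ 2 / 2048) (by linarith)).trans tm
  have t3' := (exp_tail_le hm hs2 (y := n * ε ^ 2 / 2048) (by linarith)).trans tm
  rw [← neg_div] at t3 t3'
  have e : (16 : ℝ) / (3 * (n * ε)) = 4 / 3 * (4 / (n * ε)) := by ring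
  rw [mul_div_assoc, mul_div_assoc, e]
  -- In units of `1 / (√L ε)`: `1 + 4/3 + 6.8 + 6.8 + 1 + 1 ≤ 18`.
  linarith

lemma log_le_of_sqrt_le {a L ε : ℝ} (hL : 0 < L) (hε : 0 < ε)
    (h : ‖Real.sqrt (a / L)‖ ≤ 1 / 100 * ‖ε‖) : 10000 * a ≤ L * ε ^ 2 := by
  rw [Real.norm_of_nonneg (Real.sqrt_nonneg _), Real.norm_of_nonneg hε.le] at h
  have h2 := (Real.sqrt_le_iff.1 h).2
  rw [div_le_iff₀ hL] at h2
  linarith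

end Asymptotic

end NormalizingFactors

theorem proposition4p8 {ι : Type*} (l : Filter ι) (m : ι → ℕ) (ε π₀ : ι → ℝ)
    (hε : ∀ i, ε i ∈ Set.Ioo (0 : ℝ) 1) (hπ₀ : ∀ i, π₀ i ∈ Set.Ioo (0 : ℝ) 1) :
    -- independent case
    (Tendsto m l atTop →
      (fun i => Real.sqrt (Real.log (m i) / (m i * π₀ i))) =o[l] ε →
      ∀ᶠ i in l,
        max (NormalizingFactors.factorC NormalizingFactors.lawIndep (m i) (ε i) (π₀ i))
            (NormalizingFactors.factorD NormalizingFactors.lawIndep (m i) (ε i) (π₀ i)) - 1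
          ≤ 9 / (Real.sqrt (m i * π₀ i) * ε i)) ∧
    -- conformal case
    (∀ n : ι → ℕ,
      Tendsto (fun i => min (n i) (m i)) l atTop →
      ε =o[l] (fun _ => (1 : ℝ)) →
      (fun i => Real.sqrt (Real.log (m i) / (min (n i : ℝ) (m i) * π₀ i))) =o[l] ε →
      (fun i => Real.log (m i)) =o[l] (fun i => (n i : ℝ)) →
      (fun i => 1 / (m i : ℝ)) =o[l] π₀ →
      ∀ᶠ i in l,
        max (NormalizingFactors.factorC (NormalizingFactors.lawConf (n i)) (m i) (ε i) (π₀ i))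
            (NormalizingFactors.factorD (NormalizingFactors.lawConf (n i)) (m i) (ε i) (π₀ i)) - 1
          ≤ 34 / (Real.sqrt (min (n i : ℝ) (m i) * π₀ i) * ε i ^ 2)) := by
  refine ⟨fun hm hlog => ?_, fun n hnm _ hlog _ _ => ?_⟩
  -- The constant `1/100` squares to the factor `10000`, which leaves `s ε² / 512` (and `2048` in
  -- the conformal case) above `3 log m`.
  · filter_upwards [hm.eventually_ge_atTop 3, hlog.bound (show (0 : ℝ) < 1 / 100 by norm_num)]
      with i hi hb
    have hm' : (0 : ℝ) < m i := Nat.cast_pos.2 (by omega)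
    exact NormalizingFactors.max_factor_lawIndep_sub_one_le hi (hε i) (hπ₀ i)
      (NormalizingFactors.log_le_of_sqrt_le (mul_pos hm' (hπ₀ i).1) (hε i).1 hb)
  · filter_upwards [hnm.eventually_ge_atTop 3, hlog.bound (show (0 : ℝ) < 1 / 100 by norm_num)]
      with i hi hb
    have hmi : 3 ≤ m i := hi.trans (min_le_right _ _)
    have hni : 3 ≤ n i := hi.trans (min_le_left _ _)
    have hmin : (0 : ℝ) < min (n i : ℝ) (m i) :=
      lt_min (Nat.cast_pos.2 (by omega)) (Nat.cast_pos.2 (by omega))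
    have hL : 0 < min (n i : ℝ) (m i) * π₀ i := mul_pos hmin (hπ₀ i).1
    -- The bound `18 / (√L ε)` is stronger than required, because `ε² ≤ ε`.
    refine (NormalizingFactors.max_factor_lawConf_sub_one_le hmi (by omega) (hε i) (hπ₀ i)
      (NormalizingFactors.log_le_of_sqrt_le hL (hε i).1 hb)).trans ?_
    have hε0 := (hε i).1
    have hsq : ε i ^ 2 ≤ ε i := by nlinarith [(hε i).2]
    have hr := Real.sqrt_pos.2 hL
    exact div_le_div₀ (by norm_num) (by norm_num) (by positivity)
      (mul_le_mul_of_nonneg_left hsq hr.le)
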